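/- Let $\mathbb{D}=\{z\in\mathbb{C}:|z|<1\}$. Let $\mathcal{H}$ be the class of complex-valued harmonic functions $f$ on $\mathbb{D}$ with $f(0)=0=f_z(0)-1$; such an $f$ is written $f=h+\bar g$ on $\mathbb{D}$ with $h,g$ analytic in $\mathbb{D}$, $h(0)=g(0)=0$, $$h(z)=z+\sum_{n\ge 2}a_nz^n,\qquad g(z)=\sum_{n\ge 1}b_nz^n .$$ For $\alpha\in\mathbb{C}$, let $\mathcal{M}(\alpha)$ be the set of $f=h+\bar g\in\mathcal{H}$ with $g'(z)=\alpha z h'(z)$, $h'(z)\neq 0$ and $\operatorname{Re}\bigl(1+zh''(z)/h'(z)\bigr)>-\tfrac12$ for all $z\in\mathbb{D}$. Let $\mathcal{C}_H^0$ be the set of $f\in\mathcal{H}$ that are injective and sense-preserving ($|f_{\bar z}|<|f_z|$) in $\mathbb{D}$, satisfy $f_{\bar z}(0)=0$, and map $\mathbb{D}$ onto a close-to-convex domain, i.e. a domain whose complement is a union of closed half-lines which are pairwise disjoint except that the origin of one may lie on another. Put $$f_\alpha(z)=\frac12\left(\frac{z}{1-z}+\frac{z}{(1-z)^2}\right)-\overline{\frac{\alpha}{2}\left(\frac{z}{1-z}-\frac{z}{(1-z)^2}\right)}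 .$$ **Theorem 3.1.** Let $\alpha\in\mathbb{C}$ with $|\alpha|\le 1$. (i) $\mathcal{M}(\alpha)\subset\mathcal{C}_H^0$. (ii) If $f=h+\bar g\in\mathcal{M}(\alpha)$, then $b_1=g'(0)=0$ and, for all $n\ge2$, $$|a_n|\le\frac{n+1}{2},\qquad |b_n|\le\frac{n-1}{2}|\alpha| .$$ The bounds are sharp for each $\alpha$: $f_\alpha\in\mathcal{M}(\alpha)$, and for $f_\alpha$ equality holds in both for every $n\ge2$. (iii) For every $f\in\mathcal{M}(\alpha)$ and $z\in\mathbb{D}$, $$|f(z)|\le\frac{|z|}{(1-|z|)^2}\left[1-\frac12(1-|\alpha|)|z|\right].$$ The bound is sharp for each $\alpha$: there is an $f\in\mathcal{M}(\alpha)$ such that for every $r\in[0,1)$ equality holds at some $z$ with $|z|=r$. More precisely, whenever $|\mu|=1$ and $\mu^3|\alpha|=\alpha$, the function $z\mapsto\bar\mu f_{|\alpha|}(\mu z)$ belongs to $\mathcal{M}(\alpha)$ and gives equality at $z=\bar\mu r$ for every $r\in[0,1)$ (for $\alpha\in[0,1]$ one may take $\mu=1$, i.e. $f_\alpha$ itself).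 (iv) For every $f\in\mathcal{M}(\alpha)$ the area of $f(\mathbb{D})$ (possibly $+\infty$) is at least $\pi(1-|\alpha|^2/2)$, with equality if and only if $f(z)=z+\bar\alpha\,\bar z^2/2$ on $\mathbb{D}$; this function belongs to $\mathcal{M}(\alpha)$. -/

import Mathlib

open scoped ComplexConjugate

namespace HarmonicMappings

/-- The open unit disk, as a set of complex numbers. -/
abbrev unitDisk : Set ℂ := Metric.ball (0 : ℂ) 1

/-- The Wirtinger derivative `f_z = (f_x - i f_y) / 2`. -/
noncomputable def wirtingerZ (f : ℂ → ℂ) (z : ℂ) : ℂ :=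
  (1 / 2) * (fderiv ℝ f z 1 - Complex.I * fderiv ℝ f z Complex.I)

/-- The Wirtinger derivative `f_{z̄} = (f_x + i f_y) / 2`. -/
noncomputable def wirtingerZBar (f : ℂ → ℂ) (z : ℂ) : ℂ :=
  (1 / 2) * (fderiv ℝ f z 1 + Complex.I * fderiv ℝ f z Complex.I)

/-- The class `H` of complex-valued harmonic functions in the unit disk with
`f(0) = 0 = f_z(0) - 1`. Functions are total on `ℂ`; only values on the disk matter. -/
def classH : Set (ℂ → ℂ) :=
  {f | InnerProductSpace.HarmonicOnNhd f unitDisk ∧ f 0 = 0 ∧ wirtingerZ f 0 = 1}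

/-- `f = h + conj g` on the disk, with `h`, `g` analytic there and `h(0) = g(0) = 0`. -/
structure IsDecomposition (f h g : ℂ → ℂ) : Prop where
  analytic_h : DifferentiableOn ℂ h unitDisk
  analytic_g : DifferentiableOn ℂ g unitDisk
  h_zero : h 0 = 0
  g_zero : g 0 = 0
  eq_add : ∀ z ∈ unitDisk, f z = h z + conj (g z)

/-- The `n`-th Taylor coefficient at the origin. -/
noncomputable def taylorCoeff (φ : ℂ → ℂ) (n : ℕ) : ℂ :=
  iteratedDeriv n φ 0 / (n.factorial : ℂ)

/-- Sense-preserving in the disk: `|f_{z̄}| < |f_z|`, i.e. positive Jacobian; for `f = h + conj g`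
this reads `|g'| < |h'|`. -/
def SensePreserving (f : ℂ → ℂ) : Prop :=
  ∀ z ∈ unitDisk, ‖wirtingerZBar f z‖ < ‖wirtingerZ f z‖

/-- The class `S_H` of univalent sense-preserving functions of `H`. -/
def classSH : Set (ℂ → ℂ) :=
  {f | f ∈ classH ∧ Set.InjOn f unitDisk ∧ SensePreserving f}

/-- The closed half-line with origin `p.1` and direction `p.2`. -/
def closedRay (p : ℂ × ℂ) : Set ℂ := {w | ∃ t : ℝ, 0 ≤ t ∧ w = p.1 + (t : ℂ) * p.2}

/-- The half-line with origin `p.1` and direction `p.2`, without its origin. -/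
def openRay (p : ℂ × ℂ) : Set ℂ := {w | ∃ t : ℝ, 0 < t ∧ w = p.1 + (t : ℂ) * p.2}

/-- A close-to-convex domain: a domain whose complement is a union of non-crossing half-lines,
that is, of half-lines which are pairwise disjoint except that the origin of one of them may lie
on another one. -/
structure IsCloseToConvexDomain (Ω : Set ℂ) : Prop where
  isOpen : IsOpen Ω
  isConnected : IsConnected Ω
  exists_rays : ∃ S : Set (ℂ × ℂ), (∀ p ∈ S, ‖p.2‖ = 1) ∧ Ωᶜ = ⋃ p ∈ S, closedRay p ∧
    S.PairwiseDisjoint openRay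

/-- The class `C_H` of functions of `S_H` mapping the disk onto a close-to-convex domain. -/
def classCH : Set (ℂ → ℂ) :=
  {f | f ∈ classSH ∧ IsCloseToConvexDomain (f '' unitDisk)}

/-- The class `C_H^0` of those `f` in `C_H` with `f_{z̄}(0) = 0`. -/
def classCH0 : Set (ℂ → ℂ) :=
  {f | f ∈ classCH ∧ wirtingerZBar f 0 = 0}

/-- The class `M(α)` of all `f = h + conj g` in `H` with `g'(z) = α z h'(z)` and
`Re (1 + z h''(z) / h'(z)) > -1/2` in the disk (in particular `h'` has no zeros there). -/
def classM (α : ℂ) : Set (ℂ → ℂ) :=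
  {f | f ∈ classH ∧ ∃ h g : ℂ → ℂ, IsDecomposition f h g ∧
    (∀ z ∈ unitDisk, deriv g z = α * z * deriv h z) ∧
    ∀ z ∈ unitDisk, deriv h z ≠ 0 ∧ -(1 / 2 : ℝ) < (1 + z * deriv (deriv h) z / deriv h z).re}

/-- The analytic part of the extremal function. -/
noncomputable def extremalH (z : ℂ) : ℂ := (1 / 2) * (z / (1 - z) + z / (1 - z) ^ 2)

/-- The function `g` in the extremal function `h + conj g`. -/
noncomputable def extremalG (α z : ℂ) : ℂ := -((1 / 2) * α * (z / (1 - z) - z / (1 - z) ^ 2))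

/-- The extremal function `f_α`. -/
noncomputable def extremal (α z : ℂ) : ℂ :=
  (1 / 2) * (z / (1 - z) + z / (1 - z) ^ 2) -
    conj ((1 / 2) * α * (z / (1 - z) - z / (1 - z) ^ 2))

/-- The bound in the growth theorem, as a function of `a = |α|` and `r = |z|`. -/
noncomputable def growthBound (a r : ℝ) : ℝ := r / (1 - r) ^ 2 * (1 - (1 / 2) * (1 - a) * r)

/-- The function `z + conj (α z² / 2)` of least area. -/
noncomputable def minimalArea (α z : ℂ) : ℂ := z + conj (α * z ^ 2 / 2)

end HarmonicMappings

/-! Univalence and close-to-convexity. Fix ρ < 1 and write h' = exp L. At z = ρu with |u| = 1, the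
outward normal -i ∂f/∂θ of the image curve equals ρu exp(L) w, where w = 1 - a ū³ exp(-2i Im L) and
|a| = |α|ρ < 1. Its argument exceeds that of u by D = Im(L + log w). The hypothesis says Re(zL') >
-3/2, and since |1 - w| < 1 this survives the perturbation w: D' > -3/2 along the circle. As D is
periodic, it oscillates by less than 3π, so |D/3 - c| < π/2 for a suitable constant c. The unit
field n = u exp(i(2D/3 + c)) therefore turns counterclockwise, at speed 1 + 2D'/3 > 0, and makes an
acute angle with the normal.

Attach to each f(ρu) the half-line of direction n(u). Together with f on the disk this gives a
proper local homeomorphism of the plane, which is bijective (`bijective_rayExtension`): f is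
injective on the disk, and disjoint half-lines fill the complement of the image. Letting ρ → 1, the
directions converge along an ultrafilter to half-lines that do not cross transversally
(`exists_direction_of_exhaustion`); overlapping collinear ones are then merged
(`exists_rays_of_direction`).

Coefficients. The function 1 + (2/3) z h''/h' has positive real part, so Carathéodory's bound
controls its coefficients. A recursion shows that the coefficients of h' are dominated by those of
(1 - z)⁻³, and g' = αzh' transfers this to g. Summing the bounds gives the growth estimate; f_α and
its rotations attain equality.

Area. The Jacobian is (1 - |α|²|z|²)|h'|². Expanding |h'|² = 1 + 2 Re(h' - 1) + |h' - 1|², the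
linear term integrates to zero on disks by the mean value property, and the last term is a
nonnegative defect that vanishes only if h' = 1. -/

namespace HarmonicMappings

open Filter Topology

/-! ### Proper local homeomorphisms of the plane and gluing along a circle. -/

/-- A proper local homeomorphism of the plane is bijective. -/
theorem bijective_of_isLocalHomeomorph {f : ℂ → ℂ} (hf : IsLocalHomeomorph f)
    (hp : Tendsto f (cocompact ℂ) (cocompact ℂ)) : Function.Bijective f := by
  have hprop : IsProperMap f := isProperMap_iff_tendsto_cocompact.2 ⟨hf.continuous, hp⟩
  have hcov : IsCoveringMap f := by
    rw [isCoveringMap_iff_isCoveringMapOn_univ]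
    refine hprop.isClosedMap.isCoveringMapOn_of_isLocalHomeomorphOn (fun x _ => ?_)
      (hf.isLocalHomeomorphOn.mono (Set.subset_univ _))
    refine (hprop.isCompact_preimage isCompact_singleton).finite ?_
    refine IsDiscrete.of_openPartialHomeomorph f subset_rfl fun e _ => ?_
    obtain ⟨φ, hφ, h⟩ := hf e
    exact ⟨φ, hφ, h.symm⟩
  -- The plane is simply connected, so the identity lifts through the covering `f` to a section
  -- through `e`. Then `σ ∘ f` and the identity are lifts of `f` that agree at `e`, hence coincide.
  have key : ∀ e : ℂ, ∃ σ : ℂ → ℂ, (∀ z, f (σ z) = z) ∧ ∀ z, σ (f z) = z := by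
    intro e
    obtain ⟨σ, ⟨h0, h1⟩, -⟩ :=
      hcov.existsUnique_continuousMap_lifts (ContinuousMap.id ℂ) (f e) e rfl
    have h1' : ∀ z, f (σ z) = z := fun z => congrFun h1 z
    refine ⟨σ, h1', fun z => ?_⟩
    have := hcov.eq_of_comp_eq (g₁ := σ ∘ f) (g₂ := id) (σ.continuous.comp hf.continuous)
      continuous_id (by funext z; simp [h1']) e (by simpa using h0)
    exact congrFun this z
  obtain ⟨σ, h1, h2⟩ := key 0
  exact ⟨Function.LeftInverse.injective h2, Function.RightInverse.surjective h1⟩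

theorem isLocalHomeomorph_of_locallyInjective {f : ℂ → ℂ} (hc : Continuous f)
    (hinj : ∀ x, ∃ U ∈ 𝓝 x, Set.InjOn f U) (hopen : ∀ x, 𝓝 (f x) ≤ map f (𝓝 x)) :
    IsLocalHomeomorph f := by
  rw [isLocalHomeomorph_iff_isOpenEmbedding_restrict]
  intro x
  obtain ⟨U, hU, hi⟩ := hinj x
  obtain ⟨V, hVU, hV, hxV⟩ := mem_nhds_iff.1 hU
  refine ⟨V, hV.mem_nhds hxV, ?_⟩
  have hom : IsOpenMap f := IsOpenMap.of_nhds_le hopen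
  exact IsOpenEmbedding.of_continuous_injective_isOpenMap
    (hc.comp continuous_subtype_val) (Set.injOn_iff_injective.1 (hi.mono hVU))
    (hom.comp hV.isOpenEmbedding_subtypeVal.isOpenMap)

/-- Radial projection onto the circle of radius `ρ`. -/
noncomputable def radial (ρ : ℝ) (z : ℂ) : ℂ := ((ρ / ‖z‖ : ℝ) : ℂ) * z

theorem norm_radial {ρ : ℝ} (hρ : 0 ≤ ρ) {z : ℂ} (hz : z ≠ 0) : ‖radial ρ z‖ = ρ := by
  have := norm_pos_iff.2 hz
  rw [radial, norm_mul, Complex.norm_real, Real.norm_of_nonneg (by positivity)]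
  field_simp

theorem radial_self {z : ℂ} (hz : z ≠ 0) : radial ‖z‖ z = z := by
  have := norm_pos_iff.2 hz
  rw [radial, div_self this.ne']; simp

theorem contDiffAt_radial (ρ : ℝ) {z : ℂ} (hz : z ≠ 0) : ContDiffAt ℝ 1 (radial ρ) z := by
  have h1 : ContDiffAt ℝ 1 (fun z : ℂ => ρ / ‖z‖) z :=
    contDiffAt_const.div (contDiffAt_norm ℝ hz) (norm_ne_zero_iff.2 hz)
  exact (Complex.ofRealCLM.contDiff.contDiffAt.comp z h1).mul contDiffAt_id

/-- Two local diffeomorphisms that agree on a circle and are transversal to it in the same sense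
differ by a local diffeomorphism that respects the inside and the outside of the circle. -/
theorem eventually_norm_localInverse {f F : ℂ → ℂ} {z₀ : ℂ} (hz₀ : z₀ ≠ 0)
    {A B : ℂ ≃L[ℝ] ℂ} (hf : HasStrictFDerivAt f (A : ℂ →L[ℝ] ℂ) z₀)
    (hF : HasStrictFDerivAt F (B : ℂ →L[ℝ] ℂ) z₀)
    (heq : ∀ z, ‖z‖ = ‖z₀‖ → F z = f z)
    (htr : 0 < (conj z₀ * A.symm (B z₀)).re) :
    ∀ᶠ z in 𝓝 z₀, (‖z₀‖ < ‖z‖ → ‖z₀‖ < ‖hf.localInverse f A z₀ (F z)‖) ∧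
      (‖z‖ ≤ ‖z₀‖ → ‖hf.localInverse f A z₀ (F z)‖ ≤ ‖z₀‖) := by
  set ρ := ‖z₀‖ with hρ
  have hρ0 : 0 < ρ := norm_pos_iff.2 hz₀
  set T : ℂ → ℂ := fun z => hf.localInverse f A z₀ (F z) with hT
  have hFz : F z₀ = f z₀ := heq z₀ rfl
  have hTd : HasStrictFDerivAt T ((A.symm : ℂ →L[ℝ] ℂ).comp (B : ℂ →L[ℝ] ℂ)) z₀ := by
    have := hf.to_localInverse
    rw [← hFz] at this
    exact this.comp z₀ hF
  have hTz : T z₀ = z₀ := by simp only [hT, hFz]; exact hf.localInverse_apply_image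
  have hQ := (hasStrictFDerivAt_norm_sq (T z₀)).comp z₀ hTd
  rw [hTz] at hQ
  set Q' : ℂ →L[ℝ] ℝ := (2 • innerSL ℝ z₀).comp ((A.symm : ℂ →L[ℝ] ℂ).comp (B : ℂ →L[ℝ] ℂ))
    with hQ'
  have hQz : 0 < Q' z₀ := by
    have : Q' z₀ = 2 * (conj z₀ * A.symm (B z₀)).re := by
      simp [hQ', Complex.inner]; ring
    rw [this]; positivity
  have hrad : Tendsto (radial ρ) (𝓝 z₀) (𝓝 z₀) := by
    have := (contDiffAt_radial ρ hz₀).continuousAt.tendsto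
    rwa [hρ, radial_self hz₀] at this
  have hu : Tendsto (radial 1) (𝓝 z₀) (𝓝 (radial 1 z₀)) :=
    (contDiffAt_radial 1 hz₀).continuousAt.tendsto
  have hc : 0 < Q' (radial 1 z₀) := by
    have : radial 1 z₀ = (1 / ρ : ℝ) • z₀ := by simp [radial, hρ]
    rw [this, map_smul, smul_eq_mul]; positivity
  set c := Q' (radial 1 z₀) with hcdef
  have e1 : ∀ᶠ z in 𝓝 z₀, c / 2 < Q' (radial 1 z) :=
    (Q'.continuous.continuousAt.tendsto.comp hu).eventually_const_lt (by rw [← hcdef]; linarith)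
  -- Strict differentiability is essential: `z` is compared with its radial projection, and both
  -- points vary near `z₀`.
  have e2 : ∀ᶠ z in 𝓝 z₀, ‖‖T z‖ ^ 2 - ‖T (radial ρ z)‖ ^ 2 - Q' (z - radial ρ z)‖
      ≤ (c / 4) * ‖z - radial ρ z‖ := by
    have := hQ.isLittleO.def (show 0 < c / 4 by linarith)
    exact (tendsto_id.prodMk_nhds hrad).eventually this
  have e3 : ∀ᶠ z in 𝓝 z₀, T (radial ρ z) = radial ρ z := by
    have h1 := hrad.eventually hf.eventually_left_inverse
    have h2 : ∀ᶠ z in 𝓝 z₀, z ≠ 0 := isOpen_ne.mem_nhds hz₀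
    filter_upwards [h1, h2] with z h1 h2
    simp only [hT]
    rw [heq _ (norm_radial hρ0.le h2), h1]
  have e4 : ∀ᶠ z in 𝓝 z₀, z ≠ 0 := isOpen_ne.mem_nhds hz₀
  filter_upwards [e1, e2, e3, e4] with z h1 h2 h3 h4
  have hz0 : 0 < ‖z‖ := norm_pos_iff.2 h4
  have hdiff : z - radial ρ z = (‖z‖ - ρ) • radial 1 z := by
    have : (‖z‖ : ℂ) ≠ 0 := by exact_mod_cast hz0.ne'
    simp only [radial, Complex.real_smul]
    push_cast
    field_simp
  have hn1 : ‖radial 1 z‖ = 1 := norm_radial zero_le_one h4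
  rw [h3, norm_radial hρ0.le h4, hdiff, norm_smul, hn1, map_smul, smul_eq_mul, mul_one,
    Real.norm_eq_abs, Real.norm_eq_abs, abs_le] at h2
  constructor
  · intro hz
    rw [abs_of_pos (by linarith)] at h2
    have : 0 < (‖z‖ - ρ) * (Q' (radial 1 z) - c / 4) := mul_pos (by linarith) (by linarith)
    nlinarith [norm_nonneg (T z), h2.1]
  · intro hz
    rw [abs_of_nonpos (by linarith)] at h2
    have : 0 ≤ (ρ - ‖z‖) * (Q' (radial 1 z) - c / 4) := mul_nonneg (by linarith) (by linarith)
    nlinarith [norm_nonneg (T z), h2.2]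

/-- Gluing of two local diffeomorphisms along a circle. -/
theorem local_injective_open_of_glue {f F Φ : ℂ → ℂ} {z₀ : ℂ} (hz₀ : z₀ ≠ 0)
    {A B : ℂ ≃L[ℝ] ℂ} (hf : HasStrictFDerivAt f (A : ℂ →L[ℝ] ℂ) z₀)
    (hF : HasStrictFDerivAt F (B : ℂ →L[ℝ] ℂ) z₀)
    (heq : ∀ z, ‖z‖ = ‖z₀‖ → F z = f z)
    (htr : 0 < (conj z₀ * A.symm (B z₀)).re)
    (hin : ∀ z, ‖z‖ ≤ ‖z₀‖ → Φ z = f z) (hout : ∀ z, ‖z₀‖ < ‖z‖ → Φ z = F z) :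
    (∃ U ∈ 𝓝 z₀, Set.InjOn Φ U) ∧ 𝓝 (Φ z₀) ≤ map Φ (𝓝 z₀) := by
  have hsign := eventually_norm_localInverse hz₀ hf hF heq htr
  have hFz : F z₀ = f z₀ := heq z₀ rfl
  have hfl := hf.eventually_left_inverse
  constructor
  · let e := hf.toOpenPartialHomeomorph f
    let e' := hF.toOpenPartialHomeomorph F
    have h1 : e'.source ∈ 𝓝 z₀ :=
      e'.open_source.mem_nhds hF.mem_toOpenPartialHomeomorph_source
    refine ⟨_, inter_mem (inter_mem hsign hfl) h1, ?_⟩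
    rintro z ⟨⟨hz1, hz2⟩, hz3⟩ w ⟨⟨hw1, hw2⟩, hw3⟩ hzw
    simp only [Set.mem_ofPred_eq] at hz1 hz2 hw1 hw2
    rcases le_or_gt ‖z‖ ‖z₀‖ with hz | hz <;> rcases le_or_gt ‖w‖ ‖z₀‖ with hw | hw
    · rw [hin z hz, hin w hw] at hzw
      rw [← hz2, ← hw2, hzw]
    · rw [hin z hz, hout w hw] at hzw
      have := hw1.1 hw
      rw [← hzw, hz2] at this
      linarith
    · rw [hout z hz, hin w hw] at hzw
      have := hz1.1 hz
      rw [hzw, hw2] at this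
      linarith
    · rw [hout z hz, hout w hw] at hzw
      exact e'.injOn hz3 hw3 hzw
  -- Openness: a value `v` near `f z₀` is `F z'` with `z'` near `z₀`. If the local preimage of `v`
  -- under `f` lies in the closed disk, it is a preimage under `Φ`; otherwise `z'` lies outside the
  -- disk and serves instead.
  · intro s hs
    rw [mem_map] at hs
    rw [hin z₀ le_rfl]
    have hri := hf.eventually_right_inverse
    have hinv : Tendsto (hf.localInverse f A z₀) (𝓝 (f z₀)) (𝓝 z₀) := hf.localInverse_tendsto
    have h1 := hinv.eventually hs
    have h2 : F '' {z | z ∈ Φ ⁻¹' s ∧ ((‖z₀‖ < ‖z‖ → ‖z₀‖ < ‖hf.localInverse f A z₀ (F z)‖) ∧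
      (‖z‖ ≤ ‖z₀‖ → ‖hf.localInverse f A z₀ (F z)‖ ≤ ‖z₀‖))} ∈ 𝓝 (f z₀) := by
      rw [← hFz, ← hF.map_nhds_eq_of_equiv]
      exact image_mem_map (inter_mem hs hsign)
    filter_upwards [hri, h1, h2] with v hv1 hv2 hv3
    obtain ⟨z', ⟨hz1, hz2, hz3⟩, rfl⟩ := hv3
    rcases le_or_gt ‖hf.localInverse f A z₀ (F z')‖ ‖z₀‖ with h | h
    · have : Φ (hf.localInverse f A z₀ (F z')) = F z' := by rw [hin _ h, hv1]
      rw [← this]; exact hv2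
    · have : ‖z₀‖ < ‖z'‖ := by
        by_contra! h'
        linarith [hz3 h']
      rw [← hout z' this]; exact hz1

/-! ### Extension of a map of a disk by half-lines. -/

theorem exists_continuousLinearEquiv {L : ℂ →L[ℝ] ℂ} (h : ∀ v, L v = 0 → v = 0) :
    ∃ e : ℂ ≃L[ℝ] ℂ, (e : ℂ →L[ℝ] ℂ) = L := by
  have hi : Function.Injective (L : ℂ →ₗ[ℝ] ℂ) := by
    rw [injective_iff_map_eq_zero]
    exact h
  refine ⟨(LinearEquiv.ofInjectiveEndo (L : ℂ →ₗ[ℝ] ℂ) hi).toContinuousLinearEquiv, ?_⟩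
  ext
  simp

/-- The union of the half-lines with origin `f ζ` and direction `n ζ`, `‖ζ‖ = ρ`, parametrized by
the punctured plane in such a way that `z` lies on the half-line from `f (radial ρ z)`. -/
noncomputable def rayMap (f n : ℂ → ℂ) (ρ : ℝ) (z : ℂ) : ℂ :=
  f (radial ρ z) + ((‖z‖ - ρ : ℝ) : ℂ) * n z

open Classical in
/-- The map `f` on a disk, extended by half-lines. -/
noncomputable def rayExtension (f n : ℂ → ℂ) (ρ : ℝ) (z : ℂ) : ℂ :=
  if ‖z‖ ≤ ρ then f z else rayMap f n ρ z

/-- A field of outward directions along the circle of radius `ρ`: it turns counterclockwise, and is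
transversal to the image of the circle under `f`. -/
structure IsRayField (f n : ℂ → ℂ) (ρ : ℝ) : Prop where
  contDiffAt : ∀ z ≠ 0, ContDiffAt ℝ 1 n z
  norm_eq : ∀ z ≠ 0, ‖n z‖ = 1
  hom : ∀ z, ∀ r : ℝ, 0 < r → n (r * z) = n z
  rot : ∀ z ≠ 0, ∃ k : ℝ, 0 < k ∧
    HasDerivAt (fun θ : ℝ => n (z * Complex.exp (θ * Complex.I))) (Complex.I * k * n z) 0
  angle : ∀ z, ‖z‖ = ρ →
    0 < (conj (n z) * (-Complex.I * fderiv ℝ f z (Complex.I * z))).re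

section

variable {f n : ℂ → ℂ} {ρ : ℝ}

theorem contDiffAt_rayMap (hρ : 0 < ρ) (hf : ∀ z, ‖z‖ ≤ ρ → ContDiffAt ℝ 1 f z)
    (hn : IsRayField f n ρ) {z : ℂ} (hz : z ≠ 0) : ContDiffAt ℝ 1 (rayMap f n ρ) z := by
  have h1 : ContDiffAt ℝ 1 (fun z => f (radial ρ z)) z :=
    (hf _ (norm_radial hρ.le hz).le).comp z (contDiffAt_radial ρ hz)
  have h2 : ContDiffAt ℝ 1 (fun z : ℂ => ‖z‖ - ρ) z := (contDiffAt_norm ℝ hz).sub contDiffAt_const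
  exact h1.add ((Complex.ofRealCLM.contDiff.contDiffAt.comp z h2).mul (hn.contDiffAt z hz))

theorem radial_real_mul {z : ℂ} {r : ℝ} (hr : 0 < r) : radial ρ (r * z) = radial ρ z := by
  rcases eq_or_ne z 0 with rfl | hz
  · simp [radial]
  have : (‖z‖ : ℂ) ≠ 0 := by exact_mod_cast (norm_pos_iff.2 hz).ne'
  have : (r : ℂ) ≠ 0 := by exact_mod_cast hr.ne'
  simp only [radial, norm_mul, Complex.norm_real, Real.norm_of_nonneg hr.le]
  push_cast
  field_simp

theorem radial_mul_unit {z u : ℂ} (hu : ‖u‖ = 1) : radial ρ (z * u) = radial ρ z * u := by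
  simp [radial, hu, mul_assoc]

theorem fderiv_rayMap_self (hρ : 0 < ρ) (hf : ∀ z, ‖z‖ ≤ ρ → ContDiffAt ℝ 1 f z)
    (hn : IsRayField f n ρ) {z : ℂ} (hz : z ≠ 0) :
    fderiv ℝ (rayMap f n ρ) z z = ‖z‖ * n z := by
  have hd := ((contDiffAt_rayMap hρ hf hn hz).differentiableAt one_ne_zero).hasFDerivAt
  have hcurve : HasDerivAt (fun s : ℝ => ((1 + s : ℝ) : ℂ) * z) z 0 := by
    have : HasDerivAt (fun s : ℝ => ((1 + s : ℝ) : ℂ)) ((1 : ℝ) : ℂ) 0 :=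
      ((hasDerivAt_id (0 : ℝ)).const_add 1).ofReal_comp
    simpa using this.mul_const z
  have h1 : HasDerivAt (fun s : ℝ => rayMap f n ρ (((1 + s : ℝ) : ℂ) * z))
      (fderiv ℝ (rayMap f n ρ) z z) 0 := by
    have hd' : HasFDerivAt (rayMap f n ρ) (fderiv ℝ (rayMap f n ρ) z)
      (((1 + 0 : ℝ) : ℂ) * z) := by simpa using hd
    exact hd'.comp_hasDerivAt (0 : ℝ) hcurve
  have h2 : HasDerivAt (fun s : ℝ => f (radial ρ z) + (((1 + s) * ‖z‖ - ρ : ℝ) : ℂ) * n z)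
      (‖z‖ * n z) 0 := by
    have : HasDerivAt (fun s : ℝ => (((1 + s) * ‖z‖ - ρ : ℝ) : ℂ)) ((1 * ‖z‖ : ℝ) : ℂ) 0 :=
      ((((hasDerivAt_id (0 : ℝ)).const_add 1).mul_const ‖z‖).sub_const ρ).ofReal_comp
    simpa using (this.mul_const (n z)).const_add (f (radial ρ z))
  refine h1.unique (h2.congr_of_eventuallyEq ?_)
  have : ∀ᶠ s : ℝ in 𝓝 0, -1 < s := lt_mem_nhds (by norm_num)
  filter_upwards [this] with s hs
  have hs' : 0 < 1 + s := by linarith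
  rw [rayMap, radial_real_mul hs', hn.hom z _ hs', norm_mul, Complex.norm_real,
    Real.norm_of_nonneg hs'.le]

theorem hasDerivAt_mul_exp (z : ℂ) :
    HasDerivAt (fun θ : ℝ => z * Complex.exp (θ * Complex.I)) (Complex.I * z) 0 := by
  have h0 : HasDerivAt (fun θ : ℝ => (θ : ℂ) * Complex.I) (1 * Complex.I) 0 :=
    (hasDerivAt_id (0 : ℝ)).ofReal_comp.mul_const Complex.I
  simpa [mul_comm] using h0.cexp.const_mul z

theorem fderiv_rayMap_I (hρ : 0 < ρ) (hf : ∀ z, ‖z‖ ≤ ρ → ContDiffAt ℝ 1 f z)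
    (hn : IsRayField f n ρ) {z : ℂ} (hz : z ≠ 0) :
    ∃ k : ℝ, 0 < k ∧ fderiv ℝ (rayMap f n ρ) z (Complex.I * z) =
      fderiv ℝ f (radial ρ z) (Complex.I * radial ρ z) +
        ((‖z‖ - ρ : ℝ) : ℂ) * (Complex.I * k * n z) := by
  obtain ⟨k, hk, hkd⟩ := hn.rot z hz
  refine ⟨k, hk, ?_⟩
  have hd := ((contDiffAt_rayMap hρ hf hn hz).differentiableAt one_ne_zero).hasFDerivAt
  have hfd := ((hf _ (norm_radial hρ.le hz).le).differentiableAt one_ne_zero).hasFDerivAt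
  have h1 : HasDerivAt (fun θ : ℝ => rayMap f n ρ (z * Complex.exp (θ * Complex.I)))
      (fderiv ℝ (rayMap f n ρ) z (Complex.I * z)) 0 := by
    have hd' : HasFDerivAt (rayMap f n ρ) (fderiv ℝ (rayMap f n ρ) z)
      (z * Complex.exp ((0 : ℝ) * Complex.I)) := by simpa using hd
    exact hd'.comp_hasDerivAt (0 : ℝ) (hasDerivAt_mul_exp z)
  have h2 : HasDerivAt (fun θ : ℝ => f (radial ρ z * Complex.exp (θ * Complex.I)))
      (fderiv ℝ f (radial ρ z) (Complex.I * radial ρ z)) 0 := by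
    have hd' : HasFDerivAt f (fderiv ℝ f (radial ρ z))
      (radial ρ z * Complex.exp ((0 : ℝ) * Complex.I)) := by simpa using hfd
    exact hd'.comp_hasDerivAt (0 : ℝ) (hasDerivAt_mul_exp _)
  have h3 := h2.add (hkd.const_mul ((‖z‖ - ρ : ℝ) : ℂ))
  refine h1.unique (h3.congr_of_eventuallyEq (Eventually.of_forall fun θ => ?_))
  simp only [rayMap, Pi.add_apply]
  rw [radial_mul_unit (Complex.norm_exp_ofReal_mul_I θ), norm_mul, Complex.norm_exp_ofReal_mul_I,
    mul_one]

theorem exists_decomp {z : ℂ} (hz : z ≠ 0) (v : ℂ) :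
    ∃ x y : ℝ, v = x • z + y • (Complex.I * z) := by
  refine ⟨(v / z).re, (v / z).im, ?_⟩
  have : v = v / z * z := by field_simp
  conv_lhs => rw [this, ← Complex.re_add_im (v / z)]
  simp only [Complex.real_smul]
  ring

theorem conj_mul_self_of_norm_eq_one {w : ℂ} (hw : ‖w‖ = 1) : conj w * w = 1 := by
  rw [← Complex.normSq_eq_conj_mul_self, Complex.normSq_eq_norm_sq, hw]; simp

/-- After multiplication by `conj (n z)` the radial derivative is the positive real `‖z‖`, and the
angular one has imaginary part Im(n̄T) + (‖z‖ - ρ)k. The first summand is positive by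
transversality; the second is nonnegative because the field turns counterclockwise and `z` is not
inside the circle. The differential is thus triangular with nonzero diagonal. -/
theorem fderiv_rayMap_injective (hρ : 0 < ρ) (hf : ∀ z, ‖z‖ ≤ ρ → ContDiffAt ℝ 1 f z)
    (hn : IsRayField f n ρ) {z : ℂ} (hz : ρ ≤ ‖z‖) (v : ℂ)
    (hv : fderiv ℝ (rayMap f n ρ) z v = 0) : v = 0 := by
  have hz0 : z ≠ 0 := norm_pos_iff.1 (hρ.trans_le hz)
  obtain ⟨x, y, rfl⟩ := exists_decomp hz0 v
  obtain ⟨k, hk, h2⟩ := fderiv_rayMap_I hρ hf hn hz0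
  rw [map_add, map_smul, map_smul, fderiv_rayMap_self hρ hf hn hz0, h2] at hv
  have hang := hn.angle _ (norm_radial hρ.le hz0)
  have hnr : n (radial ρ z) = n z := hn.hom z _ (div_pos hρ (norm_pos_iff.2 hz0))
  rw [hnr] at hang
  have hnn := conj_mul_self_of_norm_eq_one (hn.norm_eq z hz0)
  set T := fderiv ℝ f (radial ρ z) (Complex.I * radial ρ z)
  have h3 : (x * ‖z‖ : ℝ) + y * (conj (n z) * T + Complex.I * ((‖z‖ - ρ) * k : ℝ)) = 0 := by
    have : conj (n z) * (x • (‖z‖ * n z) + y • (T + ((‖z‖ - ρ : ℝ) : ℂ) * (Complex.I * k * n z)))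
      = (x * ‖z‖ : ℝ) * (conj (n z) * n z) + y * (conj (n z) * T +
        Complex.I * ((‖z‖ - ρ) * k : ℝ) * (conj (n z) * n z)) := by
      simp only [Complex.real_smul]; push_cast; ring
    rw [hv, hnn] at this
    simpa using this.symm
  have him := congrArg Complex.im h3
  have hre := congrArg Complex.re h3
  simp only [Complex.add_im, Complex.ofReal_im, Complex.mul_im, Complex.ofReal_re, Complex.I_re,
    Complex.I_im, Complex.zero_im] at him
  have hang' : 0 < (conj (n z) * T).im := by
    have e : conj (n z) * (-Complex.I * T) = -Complex.I * (conj (n z) * T) := by ring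
    rw [e] at hang
    simpa [Complex.mul_re] using hang
  rw [Complex.mul_im] at hang'
  have hy : y = 0 := by
    have hpos : 0 < (conj (n z) * T).im + (‖z‖ - ρ) * k :=
      add_pos_of_pos_of_nonneg (by rw [Complex.mul_im]; exact hang')
        (mul_nonneg (by linarith) hk.le)
    rw [Complex.mul_im] at hpos
    have : y * ((conj (n z)).re * T.im + (conj (n z)).im * T.re + (‖z‖ - ρ) * k) = 0 := by
      linarith
    exact (mul_eq_zero.1 this).resolve_right hpos.ne'
  subst hy
  have hx : x = 0 := by
    have : x * ‖z‖ = 0 := by simpa using hre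
    exact (mul_eq_zero.1 this).resolve_right (hρ.trans_le hz).ne'
  simp [hx]

/-- The extension is a local homeomorphism inside the circle by the Jacobian, outside because the
half-lines spread, and on the circle by gluing. It is proper because the half-lines leave a bounded
set at unit speed. -/
theorem bijective_rayExtension (hρ : 0 < ρ) (hf : ∀ z, ‖z‖ ≤ ρ → ContDiffAt ℝ 1 f z)
    (hor : ∀ z, ‖z‖ ≤ ρ → ∀ v ≠ 0,
      0 < (conj (fderiv ℝ f z v) * fderiv ℝ f z (Complex.I * v)).im)
    (hn : IsRayField f n ρ) : Function.Bijective (rayExtension f n ρ) := by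
  have hstrict : ∀ z, ‖z‖ ≤ ρ → ∃ e : ℂ ≃L[ℝ] ℂ, (e : ℂ →L[ℝ] ℂ) = fderiv ℝ f z ∧
      HasStrictFDerivAt f (e : ℂ →L[ℝ] ℂ) z := by
    intro z hz
    obtain ⟨e, he⟩ := exists_continuousLinearEquiv (L := fderiv ℝ f z) (fun v hv => by
      by_contra h
      have := hor z hz v h
      rw [hv] at this
      simp at this)
    exact ⟨e, he, he ▸ (hf z hz).hasStrictFDerivAt one_ne_zero⟩
  have hstrictF : ∀ z, ρ ≤ ‖z‖ → ∃ e : ℂ ≃L[ℝ] ℂ, (e : ℂ →L[ℝ] ℂ) = fderiv ℝ (rayMap f n ρ) z ∧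
      HasStrictFDerivAt (rayMap f n ρ) (e : ℂ →L[ℝ] ℂ) z := by
    intro z hz
    obtain ⟨e, he⟩ := exists_continuousLinearEquiv (fderiv_rayMap_injective hρ hf hn hz)
    exact ⟨e, he, he ▸ (contDiffAt_rayMap hρ hf hn
      (norm_pos_iff.1 (hρ.trans_le hz))).hasStrictFDerivAt one_ne_zero⟩
  have hin : ∀ z, ‖z‖ ≤ ρ → rayExtension f n ρ z = f z := fun z hz => if_pos hz
  have hout : ∀ z, ρ < ‖z‖ → rayExtension f n ρ z = rayMap f n ρ z :=
    fun z hz => if_neg (not_le.2 hz)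
  have hcirc : ∀ z, ‖z‖ = ρ → rayMap f n ρ z = f z := by
    intro z hz
    have : z ≠ 0 := norm_pos_iff.1 (hz ▸ hρ)
    subst hz
    simp [rayMap, radial_self this]
  have hinev : ∀ z, ‖z‖ < ρ → rayExtension f n ρ =ᶠ[𝓝 z] f := fun z hz => by
    filter_upwards [continuous_norm.continuousAt.eventually (gt_mem_nhds hz)] with w hw
      using hin w hw.le
  have houtev : ∀ z, ρ < ‖z‖ → rayExtension f n ρ =ᶠ[𝓝 z] rayMap f n ρ := fun z hz => by
    filter_upwards [continuous_norm.continuousAt.eventually (lt_mem_nhds hz)] with w hw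
      using hout w hw
  have hcont : Continuous (rayExtension f n ρ) := by
    rw [continuous_iff_continuousAt]
    intro z
    rcases lt_trichotomy ‖z‖ ρ with h | h | h
    · exact (hf z h.le).continuousAt.congr (hinev z h).symm
    · have h1 := (hf z h.le).continuousAt.tendsto
      have h2 := (contDiffAt_rayMap hρ hf hn (norm_pos_iff.1 (h ▸ hρ))).continuousAt.tendsto
      rw [hcirc z h] at h2
      rw [ContinuousAt, hin z h.le]
      exact Tendsto.if' h1 h2
    · exact (contDiffAt_rayMap hρ hf hn (norm_pos_iff.1
        (hρ.trans h))).continuousAt.congr (houtev z h).symm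
  have hloc : ∀ z, (∃ U ∈ 𝓝 z, Set.InjOn (rayExtension f n ρ) U) ∧
      𝓝 (rayExtension f n ρ z) ≤ map (rayExtension f n ρ) (𝓝 z) := by
    have gen : ∀ (G : ℂ → ℂ) (z : ℂ) (e : ℂ ≃L[ℝ] ℂ), HasStrictFDerivAt G (e : ℂ →L[ℝ] ℂ) z →
        rayExtension f n ρ =ᶠ[𝓝 z] G → (∃ U ∈ 𝓝 z, Set.InjOn (rayExtension f n ρ) U) ∧
      𝓝 (rayExtension f n ρ z) ≤ map (rayExtension f n ρ) (𝓝 z) := by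
      intro G z e he hev
      refine ⟨⟨_, inter_mem hev ((he.toOpenPartialHomeomorph G).open_source.mem_nhds
        he.mem_toOpenPartialHomeomorph_source), ?_⟩, ?_⟩
      · rintro x ⟨hx1, hx2⟩ y ⟨hy1, hy2⟩ hxy
        simp only [Set.mem_ofPred_eq] at hx1 hy1
        rw [hx1, hy1] at hxy
        exact (he.toOpenPartialHomeomorph G).injOn hx2 hy2 hxy
      · rw [Filter.map_congr hev, he.map_nhds_eq_of_equiv, hev.eq_of_nhds]
    intro z
    rcases lt_trichotomy ‖z‖ ρ with h | h | h
    · obtain ⟨e, -, he⟩ := hstrict z h.le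
      exact gen f z e he (hinev z h)
    · have hz0 : z ≠ 0 := norm_pos_iff.1 (h ▸ hρ)
      obtain ⟨A, hA, hAs⟩ := hstrict z h.le
      obtain ⟨B, hB, hBs⟩ := hstrictF z h.ge
      refine local_injective_open_of_glue hz0 hAs hBs (fun w hw => hcirc w (hw.trans h)) ?_
        (fun w hw => hin w (hw.trans_eq h)) (fun w hw => hout w (h ▸ hw))
      have hBz : B z = ‖z‖ * n z := by
        rw [← fderiv_rayMap_self hρ hf hn hz0, ← hB]; rfl
      obtain ⟨x, y, hxy⟩ := exists_decomp hz0 (A.symm (B z))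
      have h1 : (‖z‖ : ℂ) * n z = x • fderiv ℝ f z z + y • fderiv ℝ f z (Complex.I * z) := by
        rw [← map_smul, ← map_smul, ← map_add, ← hxy, ← hA, ← hBz]; simp
      have hang := hn.angle z h
      have hdet := hor z h.le z hz0
      set T := fderiv ℝ f z (Complex.I * z)
      set R := fderiv ℝ f z z
      -- Pairing with `conj T` and taking imaginary parts eliminates `y`. What remains expresses `x`
      -- as a quotient of two positive numbers: the transversality term and the Jacobian term.
      have h2 := congrArg (fun w => (conj T * w).im) h1
      have hnz : 0 < ‖z‖ := norm_pos_iff.2 hz0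
      simp only [Complex.mul_im, Complex.mul_re, Complex.conj_re, Complex.conj_im, Complex.add_re,
        Complex.add_im, Complex.real_smul, Complex.ofReal_re, Complex.ofReal_im, Complex.neg_re,
        Complex.neg_im, Complex.I_re, Complex.I_im] at h2 hang hdet
      have hx : 0 < x := by
        have h3 : x * (R.re * T.im - R.im * T.re) = ‖z‖ * ((n z).re * T.im - (n z).im * T.re) := by
          linarith
        have h4 : 0 < ‖z‖ * ((n z).re * T.im - (n z).im * T.re) := by
          apply mul_pos hnz; linarith
        rw [← h3] at h4
        exact (pos_iff_pos_of_mul_pos h4).2 (by linarith)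
      rw [hxy]
      have : conj z * (x • z + y • (Complex.I * z)) =
          (x + y * Complex.I) * (conj z * z) := by
        simp only [Complex.real_smul]; ring
      rw [this, ← Complex.normSq_eq_conj_mul_self, Complex.re_mul_ofReal]
      simpa using mul_pos hx (Complex.normSq_pos.2 hz0)
    · obtain ⟨e, -, he⟩ := hstrictF z h.le
      exact gen _ z e he (houtev z h)
  refine bijective_of_isLocalHomeomorph (isLocalHomeomorph_of_locallyInjective hcont
    (fun z => (hloc z).1) fun z => (hloc z).2) ?_
  have hcb : ContinuousOn f (Metric.closedBall 0 ρ) := fun z hz =>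
    (hf z (by simpa using hz)).continuousAt.continuousWithinAt
  obtain ⟨C, hC⟩ := (isCompact_closedBall (0 : ℂ) ρ).exists_bound_of_continuousOn hcb
  rw [← Metric.cobounded_eq_cocompact, ← tendsto_norm_atTop_iff_cobounded]
  refine tendsto_atTop_mono' _ ?_ ((tendsto_norm_cobounded_atTop (E := ℂ)).atTop_add
    (tendsto_const_nhds (x := -(ρ + C))))
  filter_upwards [tendsto_norm_cobounded_atTop.eventually_gt_atTop ρ] with z hz
  have hz0 : z ≠ 0 := norm_pos_iff.1 (hρ.trans hz)
  rw [hout z hz, rayMap]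
  have h1 := hC (radial ρ z) (by simp [norm_radial hρ.le hz0])
  have h2 : ‖((‖z‖ - ρ : ℝ) : ℂ) * n z‖ = ‖z‖ - ρ := by
    rw [norm_mul, hn.norm_eq z hz0, Complex.norm_real, Real.norm_of_nonneg (by linarith), mul_one]
  have h3 := norm_sub_le (f (radial ρ z) + ((‖z‖ - ρ : ℝ) : ℂ) * n z) (f (radial ρ z))
  rw [add_sub_cancel_left, h2] at h3
  linarith

/-- The complement of the image of a disk is foliated by half-lines. -/
theorem exists_direction_of_isRayField (hρ : 0 < ρ) (hf : ∀ z, ‖z‖ ≤ ρ → ContDiffAt ℝ 1 f z)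
    (hor : ∀ z, ‖z‖ ≤ ρ → ∀ v ≠ 0,
      0 < (conj (fderiv ℝ f z v) * fderiv ℝ f z (Complex.I * v)).im)
    (hn : IsRayField f n ρ) :
    Set.InjOn f (Metric.closedBall 0 ρ) ∧ ∃ d : ℂ → ℂ,
      (∀ w ∉ f '' Metric.closedBall 0 ρ, ‖d w‖ = 1 ∧
        ∀ t : ℝ, 0 ≤ t → w + t * d w ∉ f '' Metric.closedBall 0 ρ) ∧
      ∀ w₁ ∉ f '' Metric.closedBall 0 ρ, ∀ w₂ ∉ f '' Metric.closedBall 0 ρ, ∀ t₁ t₂ : ℝ,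
        0 ≤ t₁ → 0 ≤ t₂ → w₁ + t₁ * d w₁ = w₂ + t₂ * d w₂ → d w₁ = d w₂ := by
  have hb := bijective_rayExtension hρ hf hor hn
  have hin : ∀ z, ‖z‖ ≤ ρ → rayExtension f n ρ z = f z := fun z hz => if_pos hz
  have hout : ∀ z, ρ < ‖z‖ → rayExtension f n ρ z = rayMap f n ρ z :=
    fun z hz => if_neg (not_le.2 hz)
  refine ⟨fun x hx y hy hxy => ?_, ?_⟩
  · rw [mem_closedBall_zero_iff] at hx hy
    exact hb.1 (by rw [hin x hx, hin y hy, hxy])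
  -- The direction at `w` is that of the half-line carrying its unique preimage `p w`; two such
  -- half-lines meet only if they lie on a common one.
  choose p hp using hb.2
  have hpn : ∀ w ∉ f '' Metric.closedBall 0 ρ, ρ < ‖p w‖ := by
    intro w hw
    by_contra! h
    exact hw ⟨p w, by simpa using h, by rw [← hin _ h, hp]⟩
  have hray : ∀ w ∉ f '' Metric.closedBall 0 ρ, ∀ t : ℝ, 0 ≤ t →
      ∃ r : ℝ, 0 < r ∧ ρ < ‖r * p w‖ ∧ rayExtension f n ρ (r * p w) = w + t * n (p w) := by
    intro w hw t ht
    have h1 := hpn w hw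
    have h0 : 0 < ‖p w‖ := hρ.trans h1
    have hr : 0 < 1 + t / ‖p w‖ := by positivity
    have hnorm : ‖((1 + t / ‖p w‖ : ℝ) : ℂ) * p w‖ = ‖p w‖ + t := by
      rw [norm_mul, Complex.norm_real, Real.norm_of_nonneg hr.le]; field_simp
    refine ⟨1 + t / ‖p w‖, hr, by rw [hnorm]; linarith, ?_⟩
    rw [hout _ (by rw [hnorm]; linarith), rayMap, hn.hom _ _ hr, radial_real_mul hr, hnorm]
    have e := hp w
    rw [hout _ h1, rayMap] at e
    push_cast at e ⊢
    linear_combination e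
  refine ⟨fun w => n (p w), fun w hw => ⟨hn.norm_eq _ (norm_pos_iff.1 (hρ.trans (hpn w hw))),
    fun t ht => ?_⟩, fun w₁ hw₁ w₂ hw₂ t₁ t₂ ht₁ ht₂ h => ?_⟩
  · obtain ⟨r, -, hr, hrw⟩ := hray w hw t ht
    rintro ⟨z, hz, hzw⟩
    rw [mem_closedBall_zero_iff] at hz
    rw [← hin z hz, ← hrw] at hzw
    rw [hb.1 hzw] at hz
    linarith
  · obtain ⟨r₁, h1, -, h1'⟩ := hray w₁ hw₁ t₁ ht₁
    obtain ⟨r₂, h2, -, h2'⟩ := hray w₂ hw₂ t₂ ht₂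
    have : (r₁ : ℂ) * p w₁ = r₂ * p w₂ := hb.1 (by rw [h1', h2', h])
    show n (p w₁) = n (p w₂)
    rw [← hn.hom (p w₁) r₁ h1, this, hn.hom _ _ h2]

end

/-! ### Limits of half-line fields and merging of overlapping half-lines. -/

/-- Half-lines in the complements of an exhaustion that do not cross yield, in the limit, half-lines
in the complement of the union that do not cross transversally. -/
theorem exists_direction_of_exhaustion {Ω : Set ℂ} {K : ℕ → Set ℂ} (hK : Monotone K)
    (hKΩ : ∀ k, K k ⊆ Ω) (hΩ : ∀ w ∈ Ω, ∃ k, K k ∈ 𝓝 w) {d : ℕ → ℂ → ℂ}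
    (hd : ∀ k, ∀ w ∉ K k, ‖d k w‖ = 1 ∧ ∀ t : ℝ, 0 ≤ t → w + t * d k w ∉ K k)
    (hcross : ∀ k, ∀ w₁ ∉ K k, ∀ w₂ ∉ K k, ∀ t₁ t₂ : ℝ, 0 ≤ t₁ → 0 ≤ t₂ →
      w₁ + t₁ * d k w₁ = w₂ + t₂ * d k w₂ → d k w₁ = d k w₂) :
    ∃ D : ℂ → ℂ, (∀ w ∉ Ω, ‖D w‖ = 1 ∧ ∀ t : ℝ, 0 ≤ t → w + t * D w ∉ Ω) ∧
      ∀ w₁ ∉ Ω, ∀ w₂ ∉ Ω, ∀ t₁ t₂ : ℝ, 0 < t₁ → 0 < t₂ →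
        w₁ + t₁ * D w₁ = w₂ + t₂ * D w₂ → (conj (D w₁) * D w₂).im = 0 := by
  have hlim : ∀ w, ∃ x : ℂ, w ∉ Ω → ‖x‖ = 1 ∧ Tendsto (fun k => d k w) (hyperfilter ℕ) (𝓝 x) := by
    intro w
    by_cases hw : w ∈ Ω
    · exact ⟨0, fun h => absurd hw h⟩
    -- A limit along a single nonprincipal ultrafilter handles all points `w` at once, with no
    -- choice of subsequence.
    obtain ⟨x, hx, hx'⟩ := (isCompact_sphere (0 : ℂ) 1).ultrafilter_le_nhds
      ((hyperfilter ℕ : Ultrafilter ℕ).map fun k => d k w) (by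
        rw [le_principal_iff, Ultrafilter.mem_coe, Ultrafilter.mem_map]
        refine univ_mem' fun k => ?_
        simpa using (hd k w (fun h => hw (hKΩ k h))).1)
    exact ⟨x, fun _ => ⟨by simpa using hx, hx'⟩⟩
  choose D hD using hlim
  refine ⟨D, fun w hw => ⟨(hD w hw).1, fun t ht hmem => ?_⟩, ?_⟩
  · obtain ⟨k₀, hk₀⟩ := hΩ _ hmem
    have h1 : Tendsto (fun k => w + t * d k w) (hyperfilter ℕ) (𝓝 (w + t * D w)) :=
      ((hD w hw).2.const_mul _).const_add _
    have h2 : ∀ᶠ k in (hyperfilter ℕ : Filter ℕ), k₀ ≤ k :=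
      Nat.hyperfilter_le_atTop (eventually_ge_atTop k₀)
    obtain ⟨k, hk1, hk2⟩ := ((h1.eventually hk₀).and h2).exists
    exact (hd k w (fun h => hw (hKΩ k h))).2 t ht (hK hk2 hk1)
  · intro w₁ hw₁ w₂ hw₂ t₁ t₂ ht₁ ht₂ heq
    by_contra hJ
    have h1 := (hD w₁ hw₁).2
    have h2 := (hD w₂ hw₂).2
    have hc : ∀ {a b : ℕ → ℂ} {x y : ℂ}, Tendsto a (hyperfilter ℕ) (𝓝 x) →
        Tendsto b (hyperfilter ℕ) (𝓝 y) →
        Tendsto (fun k => (conj (a k) * b k).im) (hyperfilter ℕ) (𝓝 (conj x * y).im) := by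
      intro a b x y ha hb
      exact Complex.continuous_im.continuousAt.tendsto.comp
        ((Complex.continuous_conj.continuousAt.tendsto.comp ha).mul hb)
    have hJk := hc h1 h2
    -- Transversal crossing is stable. Cramer's rule gives the crossing parameters of the lines with
    -- directions `d k w₁`, `d k w₂`; they tend to `t₁`, `t₂`, so for some `k` they are positive,
    -- and the half-lines cross at stage `k` with different directions.
    have ht1 : Tendsto (fun k => (conj (w₁ - w₂) * d k w₂).im / (-(conj (d k w₁) * d k w₂).im))
        (hyperfilter ℕ) (𝓝 t₁) := by
      have := (hc (tendsto_const_nhds (x := w₁ - w₂)) h2).div hJk.neg (neg_ne_zero.2 hJ)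
      convert! this using 2
      have e : w₁ - w₂ = t₂ * D w₂ - t₁ * D w₁ := by linear_combination heq
      rw [e, eq_div_iff (neg_ne_zero.2 hJ)]
      simp
      ring
    have ht2 : Tendsto (fun k => (conj (d k w₁) * (w₁ - w₂)).im / (conj (d k w₁) * d k w₂).im)
        (hyperfilter ℕ) (𝓝 t₂) := by
      have := (hc h1 (tendsto_const_nhds (x := w₁ - w₂))).div hJk hJ
      convert! this using 2
      have e : w₁ - w₂ = t₂ * D w₂ - t₁ * D w₁ := by linear_combination heq
      rw [e, eq_div_iff hJ]
      simp
      ring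
    obtain ⟨k, ⟨hk1, hk2⟩, hk3⟩ := (((ht1.eventually (lt_mem_nhds ht₁)).and
      (ht2.eventually (lt_mem_nhds ht₂))).and
      (hJk.eventually (isOpen_ne.mem_nhds hJ))).exists
    have := hcross k w₁ (fun h => hw₁ (hKΩ k h)) w₂ (fun h => hw₂ (hKΩ k h)) _ _ hk1.le hk2.le (by
      set a := d k w₁
      set b := d k w₂
      rw [← sub_eq_zero]
      obtain ⟨c, hcw⟩ : ∃ c, c = w₁ - w₂ := ⟨_, rfl⟩
      rw [← hcw, show w₁ = w₂ + c by rw [hcw]; ring]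
      have hJ' : a.re * b.im - a.im * b.re ≠ 0 := by
        intro h
        apply hk3
        simp
        linarith
      have hJ'' : -(a.re * b.im - a.im * b.re) ≠ 0 := neg_ne_zero.2 hJ'
      have j1 : (conj a * b).im = a.re * b.im - a.im * b.re := by simp; ring
      have j2 : (conj c * b).im = c.re * b.im - c.im * b.re := by simp; ring
      have j3 : (conj a * c).im = a.re * c.im - a.im * c.re := by simp; ring
      rw [j1, j2, j3]
      obtain ⟨P, hP⟩ : ∃ P : ℝ, P = (c.re * b.im - c.im * b.re) / -(a.re * b.im - a.im * b.re) :=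
        ⟨_, rfl⟩
      obtain ⟨Q, hQ⟩ : ∃ Q : ℝ, Q = (a.re * c.im - a.im * c.re) / (a.re * b.im - a.im * b.re) :=
        ⟨_, rfl⟩
      rw [← hP, ← hQ]
      rw [eq_div_iff hJ''] at hP
      rw [eq_div_iff hJ'] at hQ
      apply Complex.ext
      · simp only [Complex.add_re, Complex.sub_re, Complex.re_ofReal_mul, Complex.zero_re]
        refine (mul_eq_zero.1 (?_ : (a.re * b.im - a.im * b.re) * _ = 0)).resolve_left hJ'
        linear_combination -a.re * hP - b.re * hQ
      · simp only [Complex.add_im, Complex.sub_im, Complex.im_ofReal_mul, Complex.zero_im]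
        refine (mul_eq_zero.1 (?_ : (a.re * b.im - a.im * b.re) * _ = 0)).resolve_left hJ'
        linear_combination -a.im * hP - b.im * hQ)
    rw [this] at hk3
    apply hk3
    rw [← Complex.normSq_eq_conj_mul_self, Complex.ofReal_im]

theorem eq_or_eq_neg_of_im_conj_mul {a b : ℂ} (ha : ‖a‖ = 1) (hb : ‖b‖ = 1)
    (h : (conj a * b).im = 0) : b = a ∨ b = -a := by
  have h1 : conj a * b = ((conj a * b).re : ℂ) := Complex.ext (by simp) (by simpa using h)
  have h2 : |(conj a * b).re| = 1 := by
    rw [← Real.norm_eq_abs, ← Complex.norm_real, ← h1, norm_mul, RCLike.norm_conj, ha, hb, one_mul]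
  have h3 : b = a * (conj a * b) := by
    rw [← mul_assoc, mul_comm a, conj_mul_self_of_norm_eq_one ha, one_mul]
  rcases eq_or_eq_neg_of_abs_eq h2 with h4 | h4
  · left; rw [h3, h1, h4]; simp
  · right; rw [h3, h1, h4]; simp

/-- The abscissas on a directed line of the points whose half-line points along the line. -/
def lineOrigins (Ω : Set ℂ) (D : ℂ → ℂ) (d : ℂ) (y : ℝ) : Set ℝ :=
  {x | d * (x + y * Complex.I) ∉ Ω ∧ D (d * (x + y * Complex.I)) = d}

/-- The line is covered by open half-lines of the field, of both directions. -/
def IsCoveredLine (Ω : Set ℂ) (D : ℂ → ℂ) (d : ℂ) (y : ℝ) : Prop :=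
  ∀ x : ℝ, (∃ x₁ ∈ lineOrigins Ω D d y, x₁ < x) ∨ ∃ x₂ ∈ lineOrigins Ω D (-d) (-y), x < -x₂

theorem IsCoveredLine.neg {Ω : Set ℂ} {D : ℂ → ℂ} {d : ℂ} {y : ℝ} (h : IsCoveredLine Ω D d y) :
    IsCoveredLine Ω D (-d) (-y) := by
  intro x
  rw [neg_neg, neg_neg]
  rcases h (-x) with ⟨x₁, h1, h2⟩ | ⟨x₁, h1, h2⟩
  · exact Or.inr ⟨x₁, h1, by linarith⟩
  · exact Or.inl ⟨x₁, h1, by linarith⟩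

/-- The half-lines obtained by merging overlapping half-lines of a direction field. -/
def mergedRays (Ω : Set ℂ) (D : ℂ → ℂ) : Set (ℂ × ℂ) :=
  {p | ‖p.2‖ = 1 ∧ ∃ x y : ℝ, p.1 = p.2 * (x + y * Complex.I) ∧
    ((IsCoveredLine Ω D p.2 y ∧ x = 0) ∨ (¬ IsCoveredLine Ω D p.2 y ∧
      (lineOrigins Ω D p.2 y).Nonempty ∧ x = sInf (lineOrigins Ω D p.2 y)))}

theorem line_coords_unique {d : ℂ} (hd : ‖d‖ = 1) {x y x' y' : ℝ}
    (h : d * (x + y * Complex.I) = d * (x' + y' * Complex.I)) : x = x' ∧ y = y' := by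
  have hd0 : d ≠ 0 := norm_pos_iff.1 (by rw [hd]; exact one_pos)
  have := mul_left_cancel₀ hd0 h
  exact ⟨by simpa using congrArg Complex.re this, by simpa using congrArg Complex.im this⟩

/-- Half-lines of one direction with origins arbitrarily far back would already cover the line.
Hence the infimum used as a merged origin is a genuine one. -/
theorem bddBelow_lineOrigins {Ω : Set ℂ} {D : ℂ → ℂ} {d : ℂ} {y : ℝ}
    (h : ¬ IsCoveredLine Ω D d y) : BddBelow (lineOrigins Ω D d y) := by
  by_contra hb
  rw [not_bddBelow_iff] at hb
  exact h fun x => Or.inl (hb x)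

/-- A direction field in the complement of an open set whose half-lines lie in the complement and do
not cross transversally can be reorganized into a family of non-crossing half-lines. -/
theorem exists_rays_of_direction {Ω : Set ℂ} (hΩ : IsOpen Ω) {D : ℂ → ℂ}
    (hD : ∀ w ∉ Ω, ‖D w‖ = 1 ∧ ∀ t : ℝ, 0 ≤ t → w + t * D w ∉ Ω)
    (hcross : ∀ w₁ ∉ Ω, ∀ w₂ ∉ Ω, ∀ t₁ t₂ : ℝ, 0 < t₁ → 0 < t₂ →
      w₁ + t₁ * D w₁ = w₂ + t₂ * D w₂ → (conj (D w₁) * D w₂).im = 0) :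
    ∃ S : Set (ℂ × ℂ), (∀ p ∈ S, ‖p.2‖ = 1) ∧ Ωᶜ = ⋃ p ∈ S, closedRay p ∧
      S.PairwiseDisjoint openRay := by
  -- Each point of an open merged half-line lies strictly beyond the origin of a half-line of the
  -- field on the same line, so the non-crossing hypothesis applies to it.
  have hcov : ∀ p ∈ mergedRays Ω D, ∀ q ∈ openRay p, ∃ w ∉ Ω, ∃ t : ℝ, 0 < t ∧
      q = w + t * D w ∧ (D w = p.2 ∨ D w = -p.2) := by
    rintro p ⟨hp, x, y, hpx, hS⟩ q ⟨t, ht, rfl⟩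
    have hW : (∃ x₁ ∈ lineOrigins Ω D p.2 y, x₁ < x + t) ∨
        ∃ x₂ ∈ lineOrigins Ω D (-p.2) (-y), x + t < -x₂ := by
      rcases hS with ⟨hf, -⟩ | ⟨-, hne, hx⟩
      · exact hf _
      · exact Or.inl (exists_lt_of_csInf_lt hne (by linarith))
    rcases hW with ⟨x₁, ⟨h1, h2⟩, h3⟩ | ⟨x₁, ⟨h1, h2⟩, h3⟩
    · refine ⟨_, h1, x + t - x₁, by linarith, ?_, Or.inl h2⟩
      rw [h2, hpx]; push_cast; ring
    · refine ⟨_, h1, -x₁ - (x + t), by linarith, ?_, Or.inr h2⟩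
      rw [h2, hpx]; push_cast; ring
  refine ⟨mergedRays Ω D, fun p hp => hp.1, Set.Subset.antisymm ?_ ?_, ?_⟩
  · intro w hw
    have hd := (hD w hw).1
    set d := D w with hdef
    have hx : ∃ x y : ℝ, w = d * (x + y * Complex.I) := by
      refine ⟨(conj d * w).re, (conj d * w).im, ?_⟩
      rw [Complex.re_add_im, ← mul_assoc, mul_comm d, conj_mul_self_of_norm_eq_one hd, one_mul]
    obtain ⟨x, y, hxy⟩ := hx
    have hmem : x ∈ lineOrigins Ω D d y := ⟨hxy ▸ hw, by rw [← hxy]⟩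
    simp only [Set.mem_iUnion]
    -- A covered line lies in the complement and is cut at abscissa 0 into two opposite half-lines.
    -- On any other line the half-lines of direction `d` are replaced by the single one starting at
    -- the infimum of their origins.
    by_cases hf : IsCoveredLine Ω D d y
    · rcases le_or_gt 0 x with h0 | h0
      · exact ⟨(d * ((0 : ℝ) + y * Complex.I), d), ⟨hd, 0, y, rfl, Or.inl ⟨hf, rfl⟩⟩, x, h0, by
          rw [hxy]; push_cast; ring⟩
      · exact ⟨(-d * ((0 : ℝ) + (-y : ℝ) * Complex.I), -d), ⟨by simpa using hd, 0, -y, rfl,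
          Or.inl ⟨hf.neg, rfl⟩⟩, -x, by linarith, by rw [hxy]; push_cast; ring⟩
    · refine ⟨(d * (sInf (lineOrigins Ω D d y) + y * Complex.I), d), ⟨hd, _, y, rfl,
        Or.inr ⟨hf, ⟨x, hmem⟩, rfl⟩⟩, x - sInf (lineOrigins Ω D d y), ?_, ?_⟩
      · linarith [csInf_le (bddBelow_lineOrigins hf) hmem]
      · rw [hxy]; push_cast; ring
  · intro q hq
    simp only [Set.mem_iUnion] at hq
    obtain ⟨p, hp, t, ht, hqt⟩ := hq
    have hpos : ∀ s : ℝ, 0 < s → p.1 + s * p.2 ∈ Ωᶜ := by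
      intro s hs
      obtain ⟨w, hw, r, hr, hwr, -⟩ := hcov p hp _ ⟨s, hs, rfl⟩
      rw [hwr]
      exact (hD w hw).2 r hr.le
    rcases ht.lt_or_eq with h | h
    · rw [hqt]; exact hpos t h
    -- The infimum need not be attained, so the origin belongs to the complement only as a limit of
    -- points of the open half-line.
    · have hlim : Tendsto (fun s : ℝ => p.1 + s * p.2) (𝓝[>] 0) (𝓝 q) := by
        have : Tendsto (fun s : ℝ => p.1 + s * p.2) (𝓝 0) (𝓝 (p.1 + (0 : ℝ) * p.2)) :=
          Continuous.tendsto (by fun_prop) 0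
        rw [hqt, ← h]
        exact this.mono_left nhdsWithin_le_nhds
      exact hΩ.isClosed_compl.mem_of_tendsto hlim
        (eventually_nhdsWithin_of_forall fun s hs => hpos s hs)
  · intro p hp p' hp' hne
    rw [Function.onFun, Set.disjoint_left]
    intro q hq hq'
    apply hne
    obtain ⟨w, hw, r, hr, hwr, hwd⟩ := hcov p hp q hq
    obtain ⟨w', hw', r', hr', hwr', hwd'⟩ := hcov p' hp' q hq'
    have hpar := eq_or_eq_neg_of_im_conj_mul (hD w hw).1 (hD w' hw').1
      (hcross w hw w' hw' r r' hr hr' (hwr ▸ hwr'))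
    obtain ⟨p1, d⟩ := p
    obtain ⟨p1', d'⟩ := p'
    obtain ⟨hd, x, y, hpx, hS⟩ := hp
    obtain ⟨hd', x', y', hpx', hS'⟩ := hp'
    obtain ⟨t, ht, hqt⟩ := hq
    obtain ⟨t', ht', hqt'⟩ := hq'
    simp only at hd hpx hS hd' hpx' hS' hqt hqt' hwd hwd'
    have hdd : d' = d ∨ d' = -d := by
      rcases hwd with h1 | h1 <;> rcases hwd' with h2 | h2 <;> rw [h1, h2] at hpar <;>
        try simp only [neg_neg, neg_inj] at hpar
      · exact hpar
      · rcases hpar with h | h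
        · exact Or.inr (by rw [← h, neg_neg])
        · exact Or.inl h
      · exact hpar.symm
      · rcases hpar with h | h
        · exact Or.inl h
        · exact Or.inr (by rw [← h, neg_neg])
    have hq1 : q = d * ((x + t : ℝ) + y * Complex.I) := by rw [hqt, hpx]; push_cast; ring
    rcases hdd with rfl | rfl
    · have hq2 : q = d' * ((x' + t' : ℝ) + y' * Complex.I) := by rw [hqt', hpx']; push_cast; ring
      obtain ⟨-, rfl⟩ := line_coords_unique hd (hq1.symm.trans hq2)
      have : x = x' := by
        rcases hS with ⟨h1, h2⟩ | ⟨h1, -, h2⟩ <;> rcases hS' with ⟨h1', h2'⟩ | ⟨h1', -, h2'⟩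
        · rw [h2, h2']
        · exact absurd h1 h1'
        · exact absurd h1' h1
        · rw [h2, h2']
      rw [hpx, hpx', this]
    · exfalso
      have hq2 : q = d * ((-(x' + t') : ℝ) + (-y' : ℝ) * Complex.I) := by
        rw [hqt', hpx']; push_cast; ring
      obtain ⟨hx, rfl⟩ := line_coords_unique hd (hq1.symm.trans hq2)
      rcases hS with ⟨h1, h2⟩ | ⟨h1, hne1, h2⟩ <;> rcases hS' with ⟨h1', h2'⟩ | ⟨h1', hne1', h2'⟩
      · linarith
      · exact h1' (by simpa using h1.neg)
      · exact h1 (by simpa using h1'.neg)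
      -- Two opposite half-lines that overlap cover the whole line, contrary to the assumption that
      -- it is not covered.
      · obtain ⟨x₁, hm1, hl1⟩ := exists_lt_of_csInf_lt hne1 (show _ < x + t by linarith)
        obtain ⟨x₂, hm2, hl2⟩ := exists_lt_of_csInf_lt hne1' (show _ < x' + t' by linarith)
        refine h1 fun X => ?_
        rcases lt_or_ge x₁ X with h | h
        · exact Or.inl ⟨x₁, hm1, h⟩
        · exact Or.inr ⟨x₂, by simpa using hm2, by linarith⟩

/-! ### Turning of the boundary normal and the averaged direction field. -/

/-- A periodic function that decreases at speed at most `3 / 2` oscillates by less than `3 π`. -/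
theorem exists_center_of_periodic {D : ℝ → ℝ} (hc : Continuous D)
    (hper : Function.Periodic D (2 * Real.pi)) (hmono : Monotone fun θ => D θ + 3 / 2 * θ) :
    ∃ c : ℝ, ∀ θ, |D θ / 3 - c| < Real.pi / 2 := by
  have hpi := Real.pi_pos
  have hcomp : IsCompact (Set.Icc (0 : ℝ) (2 * Real.pi)) := isCompact_Icc
  have hne : (Set.Icc (0 : ℝ) (2 * Real.pi)).Nonempty := ⟨0, by simp [hpi.le]⟩
  obtain ⟨x, -, hx⟩ := hcomp.exists_isMaxOn hne hc.continuousOn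
  obtain ⟨y₀, -, hy₀⟩ := hcomp.exists_isMinOn hne hc.continuousOn
  -- The minimum is moved into the period following the maximum point `x`. The descent from `x` to
  -- `y` then takes less than 2π, hence is less than 3π; a third of the midpoint of the range serves
  -- as `c`.
  obtain ⟨y, hy, hyy⟩ := hper.exists_mem_Ico (by positivity) y₀ x
  have hper0 : ∀ θ, ∃ θ' ∈ Set.Icc (0 : ℝ) (2 * Real.pi), D θ = D θ' := by
    intro θ
    obtain ⟨θ', h, h'⟩ := hper.exists_mem_Ico₀ (by positivity) θ
    exact ⟨θ', ⟨h.1, h.2.le⟩, h'⟩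
  have hmax : ∀ θ, D θ ≤ D x := fun θ => by
    obtain ⟨θ', h, h'⟩ := hper0 θ
    rw [h']; exact hx h
  have hmin : ∀ θ, D y ≤ D θ := fun θ => by
    obtain ⟨θ', h, h'⟩ := hper0 θ
    rw [h', ← hyy]; exact hy₀ h
  have hosc : D x - D y < 3 * Real.pi := by
    have := hmono hy.1
    simp only at this
    have h2 := hy.2
    linarith
  refine ⟨(D x + D y) / 6, fun θ => abs_lt.2 ⟨?_, ?_⟩⟩
  · linarith [hmin θ]
  · linarith [hmax θ]

/-- The factor by which the boundary derivative of the conjugate-analytic part perturbs that of the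
analytic part `exp L`. -/
noncomputable def angleFactor (L : ℂ → ℂ) (ρ : ℝ) (a u : ℂ) : ℂ :=
  1 - a * (conj u ^ 3 * Complex.exp (-(2 * ((L (ρ * u)).im : ℂ) * Complex.I)))

/-- The angle between the outward normal of the unit circle at `u` and of the boundary curve. -/
noncomputable def deviation (L : ℂ → ℂ) (ρ : ℝ) (a u : ℂ) : ℝ :=
  (L (ρ * u) + Complex.log (angleFactor L ρ a u)).im

/-- The field of directions obtained by averaging normals of the circle and of the curve. -/
noncomputable def outwardDirection (L : ℂ → ℂ) (ρ : ℝ) (a : ℂ) (c : ℝ) (z : ℂ) : ℂ :=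
  radial 1 z * Complex.exp (((2 / 3 * deviation L ρ a (radial 1 z) + c : ℝ) : ℂ) * Complex.I)

section

variable {L : ℂ → ℂ} {ρ : ℝ} {a : ℂ}

theorem norm_one_sub_angleFactor {u : ℂ} (hu : ‖u‖ = 1) : ‖1 - angleFactor L ρ a u‖ = ‖a‖ := by
  have : ‖Complex.exp (-(2 * ((L (ρ * u)).im : ℂ) * Complex.I))‖ = 1 := by
    have e : -(2 * ((L (ρ * u)).im : ℂ) * Complex.I) = ((-2 * (L (ρ * u)).im : ℝ) : ℂ) * Complex.I
      := by push_cast; ring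
    rw [e, Complex.norm_exp_ofReal_mul_I]
  simp [angleFactor, hu, this]

theorem re_pos_of_norm_one_sub_lt {w : ℂ} (h : ‖1 - w‖ < 1) : 0 < w.re := by
  have := (Complex.abs_re_le_norm (1 - w)).trans_lt h
  rw [abs_lt] at this
  simp at this
  linarith [this.2]

theorem re_angleFactor_pos (ha : ‖a‖ < 1) {u : ℂ} (hu : ‖u‖ = 1) :
    0 < (angleFactor L ρ a u).re :=
  re_pos_of_norm_one_sub_lt (by rwa [norm_one_sub_angleFactor hu])

/-- Inversion maps the disk |w - 1| < 1 onto the half-plane Re > 1/2. -/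
theorem two_mul_re_inv_sub_one_pos {w : ℂ} (h : ‖1 - w‖ < 1) : 0 < 2 * (w⁻¹).re - 1 := by
  have hw := re_pos_of_norm_one_sub_lt h
  have hw0 : w ≠ 0 := by rintro rfl; simp at hw
  have hn := Complex.normSq_pos.2 hw0
  have h2 : Complex.normSq (1 - w) < 1 := by
    rw [Complex.normSq_eq_norm_sq]; nlinarith [norm_nonneg (1 - w)]
  have h3 : Complex.normSq w < 2 * w.re := by
    rw [Complex.normSq_apply] at h2 ⊢
    simp at h2
    nlinarith
  rw [Complex.inv_re]
  have : 2 * (w.re / Complex.normSq w) - 1 = (2 * w.re - Complex.normSq w) / Complex.normSq w := by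
    field_simp
  rw [this]
  exact div_pos (by linarith) hn

theorem mul_mem_unitDisk (hρ : 0 < ρ) (hρ1 : ρ < 1) {u : ℂ} (hu : ‖u‖ = 1) :
    (ρ : ℂ) * u ∈ unitDisk := by
  simp [hu, abs_of_pos hρ, hρ1]

/-- With M = Re(zL'), the factor w has angular derivative (3 + 2M) i (1 - w), so m = M + (3 +
2M)(Re(1/w) - 1). Hence m + 3/2 = (M + 3/2)(2 Re(1/w) - 1), a product of two positive factors: the
exponent 3 of ū is what preserves the threshold -3/2. -/
theorem hasDerivAt_deviation (hρ : 0 < ρ) (hρ1 : ρ < 1) (ha : ‖a‖ < 1)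
    (hL : DifferentiableOn ℂ L unitDisk) (hre : ∀ z ∈ unitDisk, -(3 / 2) < (z * deriv L z).re)
    {u : ℂ} (hu : ‖u‖ = 1) : ∃ m : ℝ, -(3 / 2) < m ∧
      HasDerivAt (fun θ : ℝ => deviation L ρ a (u * Complex.exp (θ * Complex.I))) m 0 := by
  set z := (ρ : ℂ) * u with hz
  have hzD : z ∈ unitDisk := mul_mem_unitDisk hρ hρ1 hu
  have hLd : HasDerivAt L (deriv L z) z :=
    ((hL z hzD).differentiableAt (Metric.isOpen_ball.mem_nhds hzD)).hasDerivAt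
  have hcz : HasDerivAt (fun θ : ℝ => (ρ : ℂ) * (u * Complex.exp (θ * Complex.I)))
      (Complex.I * z) 0 := by
    have := (hasDerivAt_mul_exp u).const_mul (ρ : ℂ)
    convert! this using 1
    rw [hz]; ring
  have hl : HasDerivAt (fun θ : ℝ => L (ρ * (u * Complex.exp (θ * Complex.I))))
      (deriv L z * (Complex.I * z)) 0 := by
    have hd : HasDerivAt L (deriv L z) ((ρ : ℂ) * (u * Complex.exp ((0 : ℝ) * Complex.I))) := by
      rwa [show (ρ : ℂ) * (u * Complex.exp ((0 : ℝ) * Complex.I)) = z by simp [hz]]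
    exact hd.comp (0 : ℝ) hcz
  have hM : HasDerivAt (fun θ : ℝ => (L (ρ * (u * Complex.exp (θ * Complex.I)))).im)
      (z * deriv L z).re 0 := by
    have := Complex.imCLM.hasFDerivAt.comp_hasDerivAt (0 : ℝ) hl
    have e : (z * deriv L z).re = Complex.imCLM (deriv L z * (Complex.I * z)) := by
      simp; ring
    rw [e]; exact this
  set M := (z * deriv L z).re with hMdef
  have hconj : HasDerivAt (fun θ : ℝ => conj (u * Complex.exp (θ * Complex.I)))
      (conj (Complex.I * u)) 0 :=
    Complex.conjCLE.toContinuousLinearMap.hasFDerivAt.comp_hasDerivAt (0 : ℝ)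
      (hasDerivAt_mul_exp u)
  have hE := ((((hM.ofReal_comp).const_mul (2 : ℂ)).mul_const Complex.I).fun_neg).cexp
  have hW := (((hconj.fun_pow 3).fun_mul hE).const_mul a).const_sub 1
  have hslit : angleFactor L ρ a (u * Complex.exp ((0 : ℝ) * Complex.I)) ∈ Complex.slitPlane :=
    Or.inl (re_angleFactor_pos ha (by rw [norm_mul, Complex.norm_exp_ofReal_mul_I, hu, one_mul]))
  have hlog := (hl.fun_add (HasDerivAt.clog_real hW hslit))
  have hfin := Complex.imCLM.hasFDerivAt.comp_hasDerivAt (0 : ℝ) hlog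
  set w := angleFactor L ρ a u with hw
  have hw1 : ‖1 - w‖ < 1 := by rwa [hw, norm_one_sub_angleFactor hu]
  have hw0 : w ≠ 0 := by
    intro h
    have := re_pos_of_norm_one_sub_lt hw1
    simp [h] at this
  refine ⟨M + (3 + 2 * M) * ((w⁻¹).re - 1), ?_, ?_⟩
  · have h1 := two_mul_re_inv_sub_one_pos hw1
    have h2 := hre z hzD
    nlinarith
  · convert! hfin using 1
    have hM2 : M = Complex.imCLM (deriv L z * (Complex.I * z)) := by simp [hMdef]; ring
    rw [map_add, ← hM2]
    congr 1
    have hww : 1 - a * (conj (u * Complex.exp ((0 : ℝ) * Complex.I)) ^ 3 *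
        Complex.exp (-(2 * ((L (ρ * (u * Complex.exp ((0 : ℝ) * Complex.I)))).im : ℂ) *
          Complex.I))) = w := by
      simp [hw, angleFactor]
    rw [hww]
    have hnum : -(a * ((3 : ℕ) * conj (u * Complex.exp ((0 : ℝ) * Complex.I)) ^ (3 - 1) *
        conj (Complex.I * u) * Complex.exp (-(2 * ((L (ρ * (u * Complex.exp ((0 : ℝ) *
          Complex.I)))).im : ℂ) * Complex.I)) + conj (u * Complex.exp ((0 : ℝ) * Complex.I)) ^ 3 *
          (Complex.exp (-(2 * ((L (ρ * (u * Complex.exp ((0 : ℝ) * Complex.I)))).im : ℂ) *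
            Complex.I)) * -(2 * (M : ℂ) * Complex.I)))) = ((3 + 2 * M : ℝ) : ℂ) * Complex.I *
            (1 - w) := by
      simp [hw, angleFactor]
      ring
    rw [hnum]
    have : ((3 + 2 * M : ℝ) : ℂ) * Complex.I * (1 - w) / w =
        ((3 + 2 * M : ℝ) : ℂ) * (Complex.I * (w⁻¹ - 1)) := by
      field_simp
    rw [this]
    simp

theorem contDiffAt_deviation (hρ : 0 < ρ) (hρ1 : ρ < 1) (ha : ‖a‖ < 1)
    (hL : DifferentiableOn ℂ L unitDisk) {u : ℂ} (hu : ‖u‖ = 1) :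
    ContDiffAt ℝ 1 (deviation L ρ a) u := by
  have hzD := mul_mem_unitDisk hρ hρ1 hu
  have hLc : ContDiffAt ℝ 1 L ((ρ : ℂ) * u) :=
    ((hL.contDiffOn (n := 1) Metric.isOpen_ball).contDiffAt
      (Metric.isOpen_ball.mem_nhds hzD)).restrict_scalars ℝ
  have hl : ContDiffAt ℝ 1 (fun u : ℂ => L (ρ * u)) u :=
    hLc.comp u (contDiffAt_const.mul contDiffAt_id)
  have hM : ContDiffAt ℝ 1 (fun u : ℂ => ((L (ρ * u)).im : ℂ)) u :=
    (Complex.ofRealCLM.contDiff.contDiffAt.comp _ (Complex.imCLM.contDiff.contDiffAt.comp u hl))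
  have hconj : ContDiffAt ℝ 1 (fun u : ℂ => conj u) u := Complex.conjCLE.contDiff.contDiffAt
  have hW : ContDiffAt ℝ 1 (angleFactor L ρ a) u :=
    contDiffAt_const.sub (contDiffAt_const.mul ((hconj.pow 3).mul
      ((contDiffAt_const.mul hM).mul contDiffAt_const).neg.cexp))
  have hslit : angleFactor L ρ a u ∈ Complex.slitPlane := Or.inl (re_angleFactor_pos ha hu)
  have hlog : ContDiffAt ℝ 1 Complex.log (angleFactor L ρ a u) :=
    (Complex.contDiffAt_log hslit).restrict_scalars ℝ
  exact Complex.imCLM.contDiff.contDiffAt.comp u (hl.add (hlog.comp u hW))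

/-- The bound on the derivative makes D + 3θ/2 increasing on the circle, and periodicity then bounds
the oscillation of D. -/
theorem exists_deviation_center (hρ : 0 < ρ) (hρ1 : ρ < 1) (ha : ‖a‖ < 1)
    (hL : DifferentiableOn ℂ L unitDisk) (hre : ∀ z ∈ unitDisk, -(3 / 2) < (z * deriv L z).re) :
    ∃ c : ℝ, ∀ u : ℂ, ‖u‖ = 1 → |deviation L ρ a u / 3 - c| < Real.pi / 2 := by
  have hder : ∀ θ : ℝ, ∃ m : ℝ, -(3 / 2) < m ∧
      HasDerivAt (fun θ : ℝ => deviation L ρ a (Complex.exp (θ * Complex.I))) m θ := by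
    intro θ
    obtain ⟨m, hm, hd⟩ := hasDerivAt_deviation hρ hρ1 ha hL hre
      (Complex.norm_exp_ofReal_mul_I θ)
    refine ⟨m, hm, ?_⟩
    have hd' : HasDerivAt (fun θ' : ℝ => deviation L ρ a (Complex.exp (θ * Complex.I) *
      Complex.exp (θ' * Complex.I))) m (θ - θ) := by simpa using hd
    have := hd'.comp_sub_const θ θ
    convert! this using 3 with x
    rw [← Complex.exp_add]
    congr 1
    push_cast; ring
  have hmono : StrictMono fun θ : ℝ => deviation L ρ a (Complex.exp (θ * Complex.I)) + 3 / 2 * θ := by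
    refine strictMono_of_deriv_pos fun θ => ?_
    obtain ⟨m, hm, hd⟩ := hder θ
    refine lt_of_lt_of_eq ?_ (hd.fun_add ((hasDerivAt_id θ).const_mul (3 / 2))).deriv.symm
    linarith
  obtain ⟨c, hc⟩ := exists_center_of_periodic
    (D := fun θ : ℝ => deviation L ρ a (Complex.exp (θ * Complex.I)))
    (continuous_iff_continuousAt.2 fun θ => (hder θ).choose_spec.2.continuousAt)
    (fun θ => by
      have : Complex.exp (((θ + 2 * Real.pi : ℝ) : ℂ) * Complex.I) =
          Complex.exp (θ * Complex.I) := by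
        push_cast
        rw [add_mul, Complex.exp_add, Complex.exp_two_pi_mul_I, mul_one]
      simp only [this]) hmono.monotone
  refine ⟨c, fun u hu => ?_⟩
  have : u = Complex.exp (u.arg * Complex.I) := by
    conv_lhs => rw [← Complex.norm_mul_exp_arg_mul_I u, hu]
    simp
  rw [this]
  exact hc _

end

/-! ### Harmonic functions and their analytic parts. -/

/-- The real differential `v ↦ p v + conj (q v)`. -/
noncomputable def harmonicDifferential (p q : ℂ) : ℂ →L[ℝ] ℂ :=
  ContinuousLinearMap.mul ℝ ℂ p +
    (Complex.conjCLE : ℂ →L[ℝ] ℂ).comp (ContinuousLinearMap.mul ℝ ℂ q)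

@[simp] theorem harmonicDifferential_apply (p q v : ℂ) :
    harmonicDifferential p q v = p * v + conj (q * v) := by
  simp [harmonicDifferential]

/-- The cross product of the images of v and iv is the Jacobian |p|² - |q|² times |v|². -/
theorem harmonicDifferential_orientation {p q v : ℂ} (h : ‖q‖ < ‖p‖) (hv : v ≠ 0) :
    0 < (conj (harmonicDifferential p q v) * harmonicDifferential p q (Complex.I * v)).im := by
  have e : (conj (harmonicDifferential p q v) * harmonicDifferential p q (Complex.I * v)).im =
      ‖p * v‖ ^ 2 - ‖q * v‖ ^ 2 := by
    rw [← Complex.normSq_eq_norm_sq, ← Complex.normSq_eq_norm_sq, Complex.normSq_apply,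
      Complex.normSq_apply]
    simp
    ring
  rw [e, norm_mul, norm_mul]
  have := norm_pos_iff.2 hv
  have h2 : ‖q‖ * ‖v‖ < ‖p‖ * ‖v‖ := by gcongr
  have := norm_nonneg q
  nlinarith [mul_nonneg this (norm_nonneg v)]

section Decomposition

variable {f h g : ℂ → ℂ}

theorem differentiableAt_of_mem {φ : ℂ → ℂ} (hφ : DifferentiableOn ℂ φ unitDisk) {z : ℂ}
    (hz : z ∈ unitDisk) : DifferentiableAt ℂ φ z :=
  (hφ z hz).differentiableAt (Metric.isOpen_ball.mem_nhds hz)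

theorem analyticAt_of_mem {φ : ℂ → ℂ} (hφ : DifferentiableOn ℂ φ unitDisk) {z : ℂ}
    (hz : z ∈ unitDisk) : AnalyticAt ℂ φ z :=
  hφ.analyticAt (Metric.isOpen_ball.mem_nhds hz)

theorem zero_mem_unitDisk : (0 : ℂ) ∈ unitDisk := by simp

theorem IsDecomposition.eventuallyEq (hd : IsDecomposition f h g) {z : ℂ} (hz : z ∈ unitDisk) :
    f =ᶠ[𝓝 z] fun z => h z + conj (g z) := by
  filter_upwards [Metric.isOpen_ball.mem_nhds hz] with w hw using hd.eq_add w hw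

theorem IsDecomposition.hasFDerivAt (hd : IsDecomposition f h g) {z : ℂ} (hz : z ∈ unitDisk) :
    HasFDerivAt f (harmonicDifferential (deriv h z) (deriv g z)) z := by
  have h1 := (differentiableAt_of_mem hd.analytic_h hz).hasDerivAt.hasFDerivAt.restrictScalars ℝ
  have h2 := (differentiableAt_of_mem hd.analytic_g hz).hasDerivAt.hasFDerivAt.restrictScalars ℝ
  have h3 := h1.add ((Complex.conjCLE : ℂ →L[ℝ] ℂ).hasFDerivAt.comp z h2)
  refine (h3.congr_of_eventuallyEq (hd.eventuallyEq hz)).congr_fderiv ?_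
  ext v
  simp [mul_comm]

theorem IsDecomposition.contDiffAt (hd : IsDecomposition f h g) {z : ℂ} (hz : z ∈ unitDisk) :
    ContDiffAt ℝ 1 f z := by
  have h1 : ContDiffAt ℝ 1 h z := (analyticAt_of_mem hd.analytic_h hz).contDiffAt.restrict_scalars ℝ
  have h2 : ContDiffAt ℝ 1 g z := (analyticAt_of_mem hd.analytic_g hz).contDiffAt.restrict_scalars ℝ
  exact (h1.add (Complex.conjCLE.contDiff.contDiffAt.comp z h2)).congr_of_eventuallyEq
    (hd.eventuallyEq hz)

theorem IsDecomposition.harmonicOnNhd (hd : IsDecomposition f h g) :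
    InnerProductSpace.HarmonicOnNhd f unitDisk := by
  intro z hz
  refine (InnerProductSpace.harmonicAt_congr_nhds (hd.eventuallyEq hz)).2 ?_
  exact (analyticAt_of_mem hd.analytic_h hz).harmonicAt.add
    ((analyticAt_of_mem hd.analytic_g hz).harmonicAt.comp_CLM (Complex.conjCLE : ℂ →L[ℝ] ℂ))

theorem IsDecomposition.wirtingerZ_eq (hd : IsDecomposition f h g) {z : ℂ} (hz : z ∈ unitDisk) :
    wirtingerZ f z = deriv h z := by
  rw [wirtingerZ, (hd.hasFDerivAt hz).fderiv]
  simp only [harmonicDifferential_apply, map_mul, Complex.conj_I]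
  ring_nf
  simp
  ring

theorem IsDecomposition.wirtingerZBar_eq (hd : IsDecomposition f h g) {z : ℂ}
    (hz : z ∈ unitDisk) : wirtingerZBar f z = conj (deriv g z) := by
  rw [wirtingerZBar, (hd.hasFDerivAt hz).fderiv]
  simp only [harmonicDifferential_apply, map_mul, Complex.conj_I]
  ring_nf
  simp
  ring

theorem IsDecomposition.mem_classH (hd : IsDecomposition f h g) (h1 : deriv h 0 = 1) :
    f ∈ classH :=
  ⟨hd.harmonicOnNhd, by rw [hd.eq_add 0 zero_mem_unitDisk, hd.h_zero, hd.g_zero]; simp,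
    by rw [hd.wirtingerZ_eq zero_mem_unitDisk, h1]⟩

theorem eqOn_of_deriv_eq {φ ψ : ℂ → ℂ} (hφ : DifferentiableOn ℂ φ unitDisk)
    (hψ : DifferentiableOn ℂ ψ unitDisk) (h0 : φ 0 = ψ 0)
    (hder : ∀ z ∈ unitDisk, deriv φ z = deriv ψ z) : Set.EqOn φ ψ unitDisk :=
  Metric.isOpen_ball.eqOn_of_deriv_eq (convex_ball _ _).isPreconnected hφ hψ hder
    zero_mem_unitDisk h0

/-- The Wirtinger derivatives of `f` determine h' and g', and both functions vanish at 0. This lets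
coefficient bounds for one decomposition hold for every decomposition. -/
theorem IsDecomposition.unique {h' g' : ℂ → ℂ} (hd : IsDecomposition f h g)
    (hd' : IsDecomposition f h' g') : Set.EqOn h h' unitDisk ∧ Set.EqOn g g' unitDisk := by
  refine ⟨eqOn_of_deriv_eq hd.analytic_h hd'.analytic_h (by rw [hd.h_zero, hd'.h_zero])
    fun z hz => by rw [← hd.wirtingerZ_eq hz, hd'.wirtingerZ_eq hz],
    eqOn_of_deriv_eq hd.analytic_g hd'.analytic_g (by rw [hd.g_zero, hd'.g_zero])
    fun z hz => ?_⟩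
  have := (hd.wirtingerZBar_eq hz).symm.trans (hd'.wirtingerZBar_eq hz)
  exact (starRingEnd ℂ).injective this

end Decomposition

/-- A nonvanishing analytic function on the disk has an analytic logarithm. -/
theorem exists_log_of_ne_zero {φ : ℂ → ℂ} (hφ : DifferentiableOn ℂ φ unitDisk)
    (h0 : ∀ z ∈ unitDisk, φ z ≠ 0) : ∃ L : ℂ → ℂ, DifferentiableOn ℂ L unitDisk ∧
      (∀ z ∈ unitDisk, Complex.exp (L z) = φ z) ∧
      ∀ z ∈ unitDisk, deriv L z = deriv φ z / φ z := by
  have hd : DifferentiableOn ℂ (fun z => deriv φ z / φ z) unitDisk :=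
    (hφ.deriv Metric.isOpen_ball).div hφ h0
  obtain ⟨L, hL0, hL⟩ := hd.isExactOn_ball.with_val_at 0 (Complex.log (φ 0))
  have hLd : DifferentiableOn ℂ L unitDisk := fun z hz => (hL z hz).differentiableAt.differentiableWithinAt
  refine ⟨L, hLd, fun z hz => ?_, fun z hz => (hL z hz).deriv⟩
  -- The product φ exp(-L) has zero derivative and equals 1 at the origin.
  have key : Set.EqOn (fun z => φ z * Complex.exp (-L z)) (fun _ => 1) unitDisk := by
    refine eqOn_of_deriv_eq (hφ.mul hLd.neg.cexp) (differentiableOn_const _) ?_ fun w hw => ?_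
    · simp only [hL0, Complex.exp_neg, Complex.exp_log (h0 0 zero_mem_unitDisk)]
      exact mul_inv_cancel₀ (h0 0 zero_mem_unitDisk)
    · have := ((differentiableAt_of_mem hφ hw).hasDerivAt.fun_mul (hL w hw).fun_neg.cexp).deriv
      rw [this, deriv_const]
      have := h0 w hw
      field_simp
      ring
  have := key hz
  simp only [Complex.exp_neg] at this
  exact (eq_of_mul_inv_eq_one this).symm

/-- The analytic data of an element of `classM α`. -/
structure ClassMData (α : ℂ) (f h g : ℂ → ℂ) : Prop where
  decomp : IsDecomposition f h g
  deriv_h_zero : deriv h 0 = 1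
  dilatation : ∀ z ∈ unitDisk, deriv g z = α * z * deriv h z
  ne_zero : ∀ z ∈ unitDisk, deriv h z ≠ 0
  re_gt : ∀ z ∈ unitDisk, -(1 / 2 : ℝ) < (1 + z * deriv (deriv h) z / deriv h z).re

theorem mem_classM_iff {α : ℂ} {f : ℂ → ℂ} : f ∈ classM α ↔ ∃ h g, ClassMData α f h g := by
  constructor
  · rintro ⟨hH, h, g, hd, hg, hh⟩
    exact ⟨h, g, hd, by rw [← hd.wirtingerZ_eq zero_mem_unitDisk]; exact hH.2.2, hg,
      fun z hz => (hh z hz).1, fun z hz => (hh z hz).2⟩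
  · rintro ⟨h, g, H⟩
    exact ⟨H.decomp.mem_classH H.deriv_h_zero, h, g, H.decomp, H.dilatation,
      fun z hz => ⟨H.ne_zero z hz, H.re_gt z hz⟩⟩

/-! ### Univalence and close-to-convexity of the class. -/

section ClassM

variable {α : ℂ} {f h g : ℂ → ℂ}

theorem ClassMData.norm_deriv_lt (H : ClassMData α f h g) (hα : ‖α‖ ≤ 1) {z : ℂ}
    (hz : z ∈ unitDisk) : ‖deriv g z‖ < ‖deriv h z‖ := by
  have h0 := norm_pos_iff.2 (H.ne_zero z hz)
  rw [H.dilatation z hz, norm_mul, norm_mul]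
  have hz' : ‖z‖ < 1 := by simpa using hz
  have : ‖α‖ * ‖z‖ < 1 := by nlinarith [norm_nonneg z, norm_nonneg α]
  nlinarith

/-- The field turns at speed 1 + 2D'/3 and deviates from the boundary normal by D/3 - c up to sign.
The weight 2/3 is exactly what D' > -3/2 allows, and leaves a third of an oscillation below 3π. -/
theorem ClassMData.exists_rayField (H : ClassMData α f h g) (hα : ‖α‖ ≤ 1) {ρ : ℝ} (hρ : 0 < ρ)
    (hρ1 : ρ < 1) : ∃ n, IsRayField f n ρ := by
  obtain ⟨L, hL, hexp, hLd⟩ := exists_log_of_ne_zero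
    (H.decomp.analytic_h.deriv Metric.isOpen_ball) H.ne_zero
  have hre : ∀ z ∈ unitDisk, -(3 / 2) < (z * deriv L z).re := by
    intro z hz
    have := H.re_gt z hz
    rw [hLd z hz, ← mul_div_assoc]
    simp only [Complex.add_re, Complex.one_re] at this
    linarith
  set a := conj α * ρ with ha_def
  -- Strictness comes from ρ < 1 and so holds even when |α| = 1; the logarithm of the perturbing
  -- factor needs it.
  have ha : ‖a‖ < 1 := by
    rw [ha_def, norm_mul, RCLike.norm_conj, Complex.norm_real, Real.norm_of_nonneg hρ.le]
    nlinarith [norm_nonneg α]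
  obtain ⟨c, hc⟩ := exists_deviation_center hρ hρ1 ha hL hre
  have hunit : ∀ z : ℂ, z ≠ 0 → ‖radial 1 z‖ = 1 := fun z hz => norm_radial zero_le_one hz
  refine ⟨outwardDirection L ρ a c, ?_, ?_, ?_, ?_, ?_⟩
  · intro z hz
    have h1 := contDiffAt_radial 1 hz
    have h2 := (contDiffAt_deviation hρ hρ1 ha hL (hunit z hz)).comp z h1
    refine h1.mul ((Complex.ofRealCLM.contDiff.contDiffAt.comp z
      ((contDiffAt_const.mul h2).add contDiffAt_const)).mul contDiffAt_const).cexp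
  · intro z hz
    rw [outwardDirection, norm_mul, hunit z hz, Complex.norm_exp_ofReal_mul_I, one_mul]
  · intro z r hr
    simp only [outwardDirection, radial_real_mul hr]
  · intro z hz
    obtain ⟨m, hm, hd⟩ := hasDerivAt_deviation hρ hρ1 ha hL hre (hunit z hz)
    refine ⟨1 + 2 / 3 * m, by linarith, ?_⟩
    have h1 := hasDerivAt_mul_exp (radial 1 z)
    have h2 := ((((hd.const_mul (2 / 3)).add_const c).ofReal_comp).mul_const Complex.I).cexp
    have h3 := h1.fun_mul h2
    have e : (fun θ : ℝ => outwardDirection L ρ a c (z * Complex.exp (θ * Complex.I))) =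
        fun θ : ℝ => radial 1 z * Complex.exp (θ * Complex.I) *
          Complex.exp (((2 / 3 * deviation L ρ a (radial 1 z * Complex.exp (θ * Complex.I)) + c : ℝ)
            : ℂ) * Complex.I) := by
      funext θ
      rw [outwardDirection, radial_mul_unit (Complex.norm_exp_ofReal_mul_I θ)]
    rw [e]
    convert! h3 using 1
    simp only [outwardDirection, Complex.ofReal_zero, zero_mul, Complex.exp_zero, mul_one]
    push_cast
    ring
  · intro z hz
    have hz0 : z ≠ 0 := norm_pos_iff.1 (hz ▸ hρ)
    set u := radial 1 z with hu_def
    have hu : ‖u‖ = 1 := hunit z hz0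
    have hρc : (ρ : ℂ) ≠ 0 := by exact_mod_cast hρ.ne'
    have hzu : z = ρ * u := by
      rw [hu_def, radial, hz]; push_cast; field_simp
    have hzD : z ∈ unitDisk := by simp [hz, hρ1]
    rw [(H.decomp.hasFDerivAt hzD).fderiv, harmonicDifferential_apply, H.dilatation z hzD,
      ← hexp z hzD]
    set w := angleFactor L ρ a u with hw
    have hw0 : w ≠ 0 := by
      intro h
      have := re_angleFactor_pos (L := L) (ρ := ρ) ha hu
      rw [← hw, h] at this
      simp at this
    have hconjL : conj (L z) = L z - 2 * ((L z).im : ℂ) * Complex.I := by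
      apply Complex.ext <;> simp; ring
    -- The outward normal of the image curve is zh' - conj(zg'). Factoring out ρu exp(L) leaves the
    -- angle factor, because 1/u = ū and exp(L̄ - L) = exp(-2i Im L).
    have hN : -Complex.I * (Complex.exp (L z) * (Complex.I * z) +
        conj (α * z * Complex.exp (L z) * (Complex.I * z))) =
        ρ * u * Complex.exp (L z + Complex.log w) := by
      rw [Complex.exp_add, Complex.exp_log hw0, hw, angleFactor, ← hzu]
      simp only [map_mul, ← Complex.exp_conj, hconjL, Complex.conj_I, sub_eq_add_neg (L z),
        Complex.exp_add (L z)]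
      have huu := conj_mul_self_of_norm_eq_one hu
      have hzc : conj z = ρ * conj u := by rw [hzu]; simp
      rw [hzc, ha_def]
      have hz' : z = ρ * u := hzu
      linear_combination (Complex.exp (L z) * z) * (-Complex.I_mul_I) +
        (conj α * ρ ^ 2 * conj u ^ 2 * Complex.exp (L z) *
          Complex.exp (-(2 * ((L z).im : ℂ) * Complex.I))) * (Complex.I_mul_I + huu) +
        (conj α * ρ * conj u ^ 3 * Complex.exp (L z) *
          Complex.exp (-(2 * ((L z).im : ℂ) * Complex.I))) * hz'
    rw [hN, outwardDirection, ← hu_def]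
    have hdev : (L z + Complex.log w).im = deviation L ρ a u := by
      rw [deviation, ← hzu]
    set dv := deviation L ρ a u with hdv
    have hexpE : Complex.exp (L z + Complex.log w) =
        (Real.exp (L z + Complex.log w).re : ℂ) * Complex.exp ((dv : ℂ) * Complex.I) := by
      conv_lhs => rw [← Complex.re_add_im (L z + Complex.log w), hdev, Complex.exp_add]
      rw [Complex.ofReal_exp]
    -- The angle between field and normal is D/3 - c, so the required real part is a positive
    -- multiple of its cosine.
    have hfin : conj (u * Complex.exp (((2 / 3 * dv + c : ℝ) : ℂ) * Complex.I)) *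
        (ρ * u * Complex.exp (L z + Complex.log w)) =
        ((ρ * Real.exp (L z + Complex.log w).re : ℝ) : ℂ) *
          Complex.exp (((dv / 3 - c : ℝ) : ℂ) * Complex.I) := by
      have huu := conj_mul_self_of_norm_eq_one hu
      have : Complex.exp (((dv / 3 - c : ℝ) : ℂ) * Complex.I) =
          Complex.exp (conj (((2 / 3 * dv + c : ℝ) : ℂ) * Complex.I)) *
            Complex.exp ((dv : ℂ) * Complex.I) := by
        rw [← Complex.exp_add, map_mul, Complex.conj_ofReal, Complex.conj_I]
        congr 1
        push_cast
        ring
      rw [this, hexpE, map_mul, ← Complex.exp_conj, Complex.ofReal_mul]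
      linear_combination (Complex.exp (conj (((2 / 3 * dv + c : ℝ) : ℂ) * Complex.I)) * ρ *
        (Real.exp (L z + Complex.log w).re : ℂ) * Complex.exp ((dv : ℂ) * Complex.I)) * huu
    rw [hfin, Complex.re_ofReal_mul, Complex.exp_ofReal_mul_I_re]
    have := abs_lt.1 (hc u hu)
    exact mul_pos (mul_pos hρ (Real.exp_pos _)) (Real.cos_pos_of_mem_Ioo ⟨this.1, this.2⟩)

theorem ClassMData.exists_direction (H : ClassMData α f h g) (hα : ‖α‖ ≤ 1) {ρ : ℝ} (hρ : 0 < ρ)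
    (hρ1 : ρ < 1) :
    Set.InjOn f (Metric.closedBall 0 ρ) ∧ ∃ d : ℂ → ℂ,
      (∀ w ∉ f '' Metric.closedBall 0 ρ, ‖d w‖ = 1 ∧
        ∀ t : ℝ, 0 ≤ t → w + t * d w ∉ f '' Metric.closedBall 0 ρ) ∧
      ∀ w₁ ∉ f '' Metric.closedBall 0 ρ, ∀ w₂ ∉ f '' Metric.closedBall 0 ρ, ∀ t₁ t₂ : ℝ,
        0 ≤ t₁ → 0 ≤ t₂ → w₁ + t₁ * d w₁ = w₂ + t₂ * d w₂ → d w₁ = d w₂ := by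
  obtain ⟨n, hn⟩ := H.exists_rayField hα hρ hρ1
  have hmem : ∀ z : ℂ, ‖z‖ ≤ ρ → z ∈ unitDisk := fun z hz => by
    simpa using hz.trans_lt hρ1
  refine exists_direction_of_isRayField hρ (fun z hz => H.decomp.contDiffAt (hmem z hz))
    (fun z hz v hv => ?_) hn
  rw [(H.decomp.hasFDerivAt (hmem z hz)).fderiv]
  exact harmonicDifferential_orientation (H.norm_deriv_lt hα (hmem z hz)) hv

theorem ClassMData.injOn (H : ClassMData α f h g) (hα : ‖α‖ ≤ 1) : Set.InjOn f unitDisk := by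
  intro x hx y hy hxy
  rw [mem_ball_zero_iff] at hx hy
  obtain ⟨ρ, h1, h2⟩ := exists_between (max_lt (max_lt hx hy) one_pos)
  rw [max_lt_iff, max_lt_iff] at h1
  exact (H.exists_direction hα h1.2 h2).1 (by simpa using h1.1.1.le) (by simpa using h1.1.2.le) hxy

theorem ClassMData.map_nhds (H : ClassMData α f h g) (hα : ‖α‖ ≤ 1) {z : ℂ} (hz : z ∈ unitDisk) :
    map f (𝓝 z) = 𝓝 (f z) := by
  have hfd := (H.decomp.hasFDerivAt hz)
  obtain ⟨e, he⟩ := exists_continuousLinearEquiv (L := fderiv ℝ f z) (fun v hv => by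
    by_contra h
    have := harmonicDifferential_orientation (H.norm_deriv_lt hα hz) h
    rw [← hfd.fderiv, hv] at this
    simp at this)
  have hs := (H.decomp.contDiffAt hz).hasStrictFDerivAt one_ne_zero
  rw [← he] at hs
  exact hs.map_nhds_eq_of_equiv

theorem ClassMData.isCloseToConvexDomain (H : ClassMData α f h g) (hα : ‖α‖ ≤ 1) :
    IsCloseToConvexDomain (f '' unitDisk) := by
  have hopen : IsOpen (f '' unitDisk) := by
    rw [isOpen_iff_mem_nhds]
    rintro _ ⟨z, hz, rfl⟩
    rw [← H.map_nhds hα hz]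
    exact image_mem_map (Metric.isOpen_ball.mem_nhds hz)
  have hcont : ContinuousOn f unitDisk := fun z hz =>
    (H.decomp.contDiffAt hz).continuousAt.continuousWithinAt
  refine ⟨hopen, ⟨⟨f 0, 0, zero_mem_unitDisk, rfl⟩,
    (convex_ball _ _).isPreconnected.image f hcont⟩, ?_⟩
  -- The shift by 2 keeps all radii positive, beginning with 1/2.
  set r : ℕ → ℝ := fun k => 1 - 1 / ((k : ℝ) + 2) with hr
  have hr1 : ∀ k, r k < 1 := fun k => by
    have : (0 : ℝ) < 1 / ((k : ℝ) + 2) := by positivity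
    simp only [hr]; linarith
  have hr0 : ∀ k, 0 < r k := fun k => by
    have : 1 / ((k : ℝ) + 2) < 1 := by
      rw [div_lt_one (by positivity)]; linarith [Nat.cast_nonneg (α := ℝ) k]
    simp only [hr]; linarith
  have hrm : Monotone r := fun i j hij => by
    have : (i : ℝ) ≤ j := by exact_mod_cast hij
    simp only [hr]
    gcongr
  choose d hd using fun k => (H.exists_direction hα (hr0 k) (hr1 k)).2
  obtain ⟨D, hD, hcross⟩ := exists_direction_of_exhaustion (Ω := f '' unitDisk)
    (K := fun k => f '' Metric.closedBall 0 (r k))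
    (fun i j hij => Set.image_mono (Metric.closedBall_subset_closedBall (hrm hij)))
    (fun k => Set.image_mono (Metric.closedBall_subset_ball (hr1 k)))
    (by
      rintro _ ⟨z, hz, rfl⟩
      have hz' : 0 < 1 - ‖z‖ := by simpa using hz
      obtain ⟨k, hk⟩ := exists_nat_one_div_lt hz'
      refine ⟨k, ?_⟩
      rw [← H.map_nhds hα hz]
      refine image_mem_map (Metric.closedBall_mem_nhds_of_mem ?_)
      have : 1 / ((k : ℝ) + 2) ≤ 1 / ((k : ℝ) + 1) := by gcongr; norm_num
      simp only [hr, mem_ball_zero_iff]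
      linarith)
    (fun k => (hd k).1) (fun k => (hd k).2)
  exact exists_rays_of_direction hopen hD hcross

theorem classM_subset_classCH0 (hα : ‖α‖ ≤ 1) : classM α ⊆ classCH0 := by
  intro f hf
  obtain ⟨h, g, H⟩ := mem_classM_iff.1 hf
  refine ⟨⟨⟨hf.1, H.injOn hα, fun z hz => ?_⟩, H.isCloseToConvexDomain hα⟩, ?_⟩
  · rw [H.decomp.wirtingerZ_eq hz, H.decomp.wirtingerZBar_eq hz, RCLike.norm_conj]
    exact H.norm_deriv_lt hα hz
  · rw [H.decomp.wirtingerZBar_eq zero_mem_unitDisk, H.dilatation 0 zero_mem_unitDisk]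
    simp

end ClassM

/-! ### Cauchy averages and Carathéodory's coefficient bound. -/

theorem diffContOnCl_of_lt_one {φ : ℂ → ℂ} (hφ : DifferentiableOn ℂ φ unitDisk) {r : ℝ}
    (hr1 : r < 1) : DiffContOnCl ℂ φ (Metric.ball 0 r) :=
  (hφ.mono ((Metric.closure_ball_subset_closedBall).trans
    (Metric.closedBall_subset_ball hr1))).diffContOnCl

theorem taylorCoeff_eq_circleAverage {φ : ℂ → ℂ} (hφ : DifferentiableOn ℂ φ unitDisk) {r : ℝ}
    (hr : 0 < r) (hr1 : r < 1) (n : ℕ) :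
    taylorCoeff φ n = Real.circleAverage (fun z => (z ^ n)⁻¹ * φ z) 0 r := by
  have h := (diffContOnCl_of_lt_one hφ hr1).circleIntegral_one_div_sub_center_pow_smul hr n
  have hpi : (2 * Real.pi * Complex.I : ℂ) ≠ 0 := Complex.two_pi_I_ne_zero
  rw [Real.circleAverage_eq_circleIntegral hr.ne', taylorCoeff]
  have e : (fun z : ℂ => (z - 0)⁻¹ • ((z ^ n)⁻¹ * φ z)) =
      fun z : ℂ => (1 / (z - 0) ^ (n + 1)) • φ z := by
    funext z
    simp only [sub_zero, smul_eq_mul, one_div, pow_succ, mul_inv]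
    ring
  rw [e, h, smul_eq_mul, smul_eq_mul]
  field_simp

theorem circleIntegrable_of_continuousOn_unitDisk {φ : ℂ → ℂ} (hφ : ContinuousOn φ unitDisk)
    {r : ℝ} (hr : 0 ≤ r) (hr1 : r < 1) : CircleIntegrable φ 0 r :=
  (hφ.mono (Metric.sphere_subset_closedBall.trans
    (Metric.closedBall_subset_ball hr1))).circleIntegrable hr

/-- Carathéodory's coefficient estimate for `1 + z q` of positive real part. -/
theorem norm_taylorCoeff_le_two {q : ℂ → ℂ} (hq : DifferentiableOn ℂ q unitDisk)
    (hre : ∀ z ∈ unitDisk, 0 < (1 + z * q z).re) (n : ℕ) : ‖taylorCoeff q n‖ ≤ 2 := by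
  have main : ∀ r : ℝ, 0 < r → r < 1 → ‖taylorCoeff q n‖ * r ^ (n + 1) ≤ 2 := by
    intro r hr hr1
    have hPd : DifferentiableOn ℂ (fun z => 1 + z * q z) unitDisk :=
      (differentiableOn_const _).add (differentiableOn_id.mul hq)
    -- The n-th coefficient of q is the coefficient of index n + 1 of P = 1 + zq.
    set m := n + 1 with hm
    have hzm : DifferentiableOn ℂ (fun z : ℂ => z ^ m) unitDisk := differentiableOn_id.pow m
    have mean : ∀ {φ : ℂ → ℂ}, DifferentiableOn ℂ φ unitDisk →
        Real.circleAverage φ 0 r = φ 0 := fun {φ} hφ =>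
      DiffContOnCl.circleAverage (by rw [abs_of_pos hr]; exact diffContOnCl_of_lt_one hφ hr1)
    have hsph : ∀ z ∈ Metric.sphere (0 : ℂ) |r|, z ∈ unitDisk ∧ z ≠ 0 ∧ conj z = r ^ 2 / z := by
      intro z hz
      rw [abs_of_pos hr, mem_sphere_zero_iff_norm] at hz
      have hz0 : z ≠ 0 := norm_pos_iff.1 (hz ▸ hr)
      refine ⟨by simp [hz, hr1], hz0, ?_⟩
      rw [eq_div_iff hz0, ← Complex.normSq_eq_conj_mul_self, Complex.normSq_eq_norm_sq, hz]
      push_cast; rfl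
    have hcm : Continuous fun z : ℂ => conj z ^ m := Complex.continuous_conj.pow m
    have i1 : CircleIntegrable (fun z => conj z ^ m * (1 + z * q z)) 0 r :=
      circleIntegrable_of_continuousOn_unitDisk (hcm.continuousOn.mul hPd.continuousOn) hr.le hr1
    have i2 : CircleIntegrable (fun z => z ^ m * (1 + z * q z)) 0 r :=
      circleIntegrable_of_continuousOn_unitDisk (hzm.continuousOn.mul hPd.continuousOn) hr.le hr1
    have i3 : CircleIntegrable (fun z : ℂ => z ^ m) 0 r :=
      circleIntegrable_of_continuousOn_unitDisk hzm.continuousOn hr.le hr1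
    have i4 : CircleIntegrable (fun z : ℂ => conj z ^ m) 0 r :=
      circleIntegrable_of_continuousOn_unitDisk hcm.continuousOn hr.le hr1
    have i5 : CircleIntegrable (fun z : ℂ => conj z ^ m * (z * q z)) 0 r :=
      circleIntegrable_of_continuousOn_unitDisk (hcm.continuousOn.mul
        (continuousOn_id.mul hq.continuousOn)) hr.le hr1
    have a3 : Real.circleAverage (fun z : ℂ => conj z ^ m) 0 r = 0 := by
      have := (Complex.conjCLE : ℂ →L[ℝ] ℂ).circleAverage_comp_comm i3
      rw [mean hzm] at this
      simpa [hm, Function.comp_def] using this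
    -- On the circle z̄ = r²/z, so averaging against z̄ᵐ extracts a Taylor coefficient.
    have a5 : Real.circleAverage (fun z => conj z ^ m * (z * q z)) 0 r =
        (r : ℂ) ^ (2 * m) * taylorCoeff q n := by
      rw [taylorCoeff_eq_circleAverage hq hr hr1, ← smul_eq_mul, ← Real.circleAverage_fun_smul]
      refine Real.circleAverage_congr_sphere fun z hz => ?_
      obtain ⟨-, hz0, hc⟩ := hsph z hz
      simp only [hc, smul_eq_mul, div_pow, hm]
      field_simp
      ring
    have a1 : Real.circleAverage (fun z => conj z ^ m * (1 + z * q z)) 0 r =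
        (r : ℂ) ^ (2 * m) * taylorCoeff q n := by
      have := Real.circleAverage_fun_add i4 i5
      rw [a3, a5, zero_add] at this
      rw [← this]
      congr 1
      funext z
      ring
    have i2' : CircleIntegrable (fun z : ℂ => conj (z ^ m * (1 + z * q z))) 0 r :=
      circleIntegrable_of_continuousOn_unitDisk
        (Complex.continuous_conj.comp_continuousOn (hzm.continuousOn.mul hPd.continuousOn)) hr.le hr1
    have a2 : Real.circleAverage (fun z => conj (z ^ m * (1 + z * q z))) 0 r = 0 := by
      have := (Complex.conjCLE : ℂ →L[ℝ] ℂ).circleAverage_comp_comm i2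
      rw [mean (φ := fun z => z ^ m * (1 + z * q z)) (hzm.mul hPd)] at this
      simpa [hm, Function.comp_def] using this
    -- The conjugate of zᵐP has mean zero, so P may be replaced by P + P̄ = 2 Re P. Positivity then
    -- bounds the average by 2rᵐ times the mean of Re P, which is 1.
    have a6 : Real.circleAverage (fun z => conj z ^ m * ((2 * (1 + z * q z).re : ℝ) : ℂ)) 0 r =
        (r : ℂ) ^ (2 * m) * taylorCoeff q n := by
      have := Real.circleAverage_fun_add i1 i2'
      rw [a1, a2, add_zero] at this
      rw [← this]
      congr 1
      funext z
      have : ((2 * (1 + z * q z).re : ℝ) : ℂ) = (1 + z * q z) + conj (1 + z * q z) := by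
        rw [Complex.add_conj]
      rw [this, map_mul, map_pow]
      ring
    have iP : CircleIntegrable (fun z => 1 + z * q z) 0 r :=
      circleIntegrable_of_continuousOn_unitDisk hPd.continuousOn hr.le hr1
    have a7 : Real.circleAverage (fun z => (1 + z * q z).re) 0 r = 1 := by
      have := Complex.reCLM.circleAverage_comp_comm iP
      rw [mean hPd] at this
      simpa [Function.comp_def] using this
    have a8 : ‖Real.circleAverage (fun z => conj z ^ m * ((2 * (1 + z * q z).re : ℝ) : ℂ)) 0 r‖ ≤
        Real.circleAverage (fun z => (2 * r ^ m) * (1 + z * q z).re) 0 r := by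
      rw [Real.circleAverage_def, Real.circleAverage_def, norm_smul, smul_eq_mul, Real.norm_eq_abs,
        abs_of_pos (by positivity)]
      refine mul_le_mul_of_nonneg_left ?_ (by positivity)
      refine intervalIntegral.norm_integral_le_of_norm_le (by positivity)
        (Eventually.of_forall fun θ _ => ?_) ?_
      · have hn : ‖circleMap 0 r θ‖ = r := by simp [abs_of_pos hr]
        have hp := hre (circleMap 0 r θ) (by rw [mem_ball_zero_iff, hn]; exact hr1)
        rw [norm_mul, norm_pow, RCLike.norm_conj, hn, Complex.norm_real,
          Real.norm_of_nonneg (by linarith)]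
        apply le_of_eq; ring
      · have : ContinuousOn (fun z => (2 * r ^ m) * (1 + z * q z).re) unitDisk :=
          continuousOn_const.mul (Complex.continuous_re.comp_continuousOn hPd.continuousOn)
        exact (this.mono (Metric.sphere_subset_closedBall.trans
          (Metric.closedBall_subset_ball hr1))).circleIntegrable hr.le
    have a9 : Real.circleAverage (fun z => (2 * r ^ m) * (1 + z * q z).re) 0 r = 2 * r ^ m := by
      have := Real.circleAverage_fun_smul (a := 2 * r ^ m) (f := fun z => (1 + z * q z).re)
        (c := 0) (R := r)
      rw [a7] at this
      simpa using this
    rw [a6, a9, norm_mul, norm_pow, Complex.norm_real, Real.norm_of_nonneg hr.le] at a8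
    have hrm : 0 < r ^ m := by positivity
    have : r ^ m * (‖taylorCoeff q n‖ * r ^ m) ≤ r ^ m * 2 := by
      calc _ = r ^ (2 * m) * ‖taylorCoeff q n‖ := by ring
        _ ≤ _ := by linarith
    exact le_of_mul_le_mul_left this hrm
  have hlim : Tendsto (fun r : ℝ => ‖taylorCoeff q n‖ * r ^ (n + 1)) (𝓝[<] 1)
      (𝓝 (‖taylorCoeff q n‖)) := by
    have : Tendsto (fun r : ℝ => ‖taylorCoeff q n‖ * r ^ (n + 1)) (𝓝 1)
        (𝓝 (‖taylorCoeff q n‖ * 1 ^ (n + 1))) := Continuous.tendsto (by fun_prop) 1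
    rw [one_pow, mul_one] at this
    exact this.mono_left nhdsWithin_le_nhds
  refine le_of_tendsto hlim ?_
  filter_upwards [Ioo_mem_nhdsLT (zero_lt_one (α := ℝ))] with r hr using main r hr.1 hr.2

/-! ### Calculus of Taylor coefficients. -/

theorem taylorCoeff_congr {φ ψ : ℂ → ℂ} (h : Set.EqOn φ ψ unitDisk) (n : ℕ) :
    taylorCoeff φ n = taylorCoeff ψ n := by
  have : φ =ᶠ[𝓝 0] ψ := by
    filter_upwards [Metric.isOpen_ball.mem_nhds zero_mem_unitDisk] with z hz using h hz
  rw [taylorCoeff, taylorCoeff, (this.iteratedDeriv n).eq_of_nhds]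

theorem taylorCoeff_deriv (φ : ℂ → ℂ) (n : ℕ) :
    taylorCoeff (deriv φ) n = (n + 1) * taylorCoeff φ (n + 1) := by
  have : (n.factorial : ℂ) ≠ 0 := by exact_mod_cast n.factorial_ne_zero
  have h2 : (n + 1 : ℂ) ≠ 0 := by exact_mod_cast n.succ_ne_zero
  rw [taylorCoeff, taylorCoeff, iteratedDeriv_succ', Nat.factorial_succ]
  push_cast
  field_simp

theorem taylorCoeff_mul {φ ψ : ℂ → ℂ} (hφ : AnalyticAt ℂ φ 0) (hψ : AnalyticAt ℂ ψ 0) (n : ℕ) :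
    taylorCoeff (fun z => φ z * ψ z) n =
      ∑ i ∈ Finset.range (n + 1), taylorCoeff φ i * taylorCoeff ψ (n - i) := by
  rw [taylorCoeff, iteratedDeriv_fun_mul hφ.contDiffAt hψ.contDiffAt, Finset.sum_div]
  refine Finset.sum_congr rfl fun i hi => ?_
  have hin : i ≤ n := Nat.lt_succ_iff.1 (Finset.mem_range.1 hi)
  rw [Nat.cast_choose ℂ hin, taylorCoeff, taylorCoeff]
  have h1 : (n.factorial : ℂ) ≠ 0 := by exact_mod_cast n.factorial_ne_zero
  have h2 : (i.factorial : ℂ) ≠ 0 := by exact_mod_cast i.factorial_ne_zero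
  have h3 : ((n - i).factorial : ℂ) ≠ 0 := by exact_mod_cast (n - i).factorial_ne_zero
  field_simp

theorem taylorCoeff_const_mul {φ : ℂ → ℂ} (c : ℂ) (n : ℕ) :
    taylorCoeff (fun z => c * φ z) n = c * taylorCoeff φ n := by
  rw [taylorCoeff, taylorCoeff, iteratedDeriv_const_mul_field, mul_div_assoc]

theorem hasSum_taylorCoeff {φ : ℂ → ℂ} (hφ : DifferentiableOn ℂ φ unitDisk) {z : ℂ}
    (hz : z ∈ unitDisk) : HasSum (fun n => taylorCoeff φ n * z ^ n) (φ z) := by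
  have := Complex.hasSum_taylorSeries_on_ball hφ hz
  convert! this using 2 with n
  simp only [taylorCoeff, sub_zero, smul_eq_mul]
  ring

theorem taylorCoeff_eq_of_hasSum {φ : ℂ → ℂ} {a : ℕ → ℂ}
    (h : ∀ z ∈ unitDisk, HasSum (fun n => a n * z ^ n) (φ z)) (n : ℕ) : taylorCoeff φ n = a n := by
  have h1 : HasFPowerSeriesAt φ (FormalMultilinearSeries.ofScalars ℂ a) 0 := by
    rw [hasFPowerSeriesAt_iff]
    filter_upwards [Metric.isOpen_ball.mem_nhds zero_mem_unitDisk] with z hz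
    simpa [mul_comm] using h z hz
  have h2 := AnalyticAt.hasFPowerSeriesAt h1.analyticAt
  have := congrArg (fun p => FormalMultilinearSeries.coeff p n) (h2.eq_formalMultilinearSeries h1)
  simpa [taylorCoeff] using this

theorem taylorCoeff_id_mul {φ : ℂ → ℂ} (hφ : AnalyticAt ℂ φ 0) (n : ℕ) :
    taylorCoeff (fun z => z * φ z) (n + 1) = taylorCoeff φ n ∧
      taylorCoeff (fun z => z * φ z) 0 = 0 := by
  have hid : ∀ k, taylorCoeff (fun z : ℂ => z) k = if k = 1 then 1 else 0 := by
    intro k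
    refine taylorCoeff_eq_of_hasSum (a := fun k => if k = 1 then 1 else 0) (fun z _ => ?_) k
    convert! hasSum_single (f := fun n => (if n = 1 then 1 else 0) * z ^ n) 1
      (fun n hn => by simp [hn]) using 1
    simp
  refine ⟨?_, by simp [taylorCoeff]⟩
  rw [taylorCoeff_mul (φ := fun z => z) analyticAt_id hφ, Finset.sum_eq_single 1]
  · simp [hid]
  · intro i _ hi
    simp [hid, hi]
  · intro h
    simp at h

/-! ### Coefficient estimates for the class. -/

section ClassM

variable {α : ℂ} {f h g : ℂ → ℂ}

theorem sum_range_triangular (n : ℕ) :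
    ∑ i ∈ Finset.range (n + 1), (((n - i : ℕ) : ℝ) + 1) * (((n - i : ℕ) : ℝ) + 2) / 2 =
      ((n : ℝ) + 1) * (n + 2) * (n + 3) / 6 := by
  have := Finset.sum_range_reflect (fun j : ℕ => ((j : ℝ) + 1) * ((j : ℝ) + 2) / 2) (n + 1)
  simp only [Nat.add_sub_cancel] at this
  rw [this]
  clear this
  induction n with
  | zero => norm_num
  | succ n ih => rw [Finset.sum_range_succ, ih]; push_cast; ring

/-- From h'' = (3/2) q h' comes (n + 1)c_{n+1} = (3/2) Σ q_i c_{n-i} for the coefficients of h'.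
With |q_i| ≤ 2, strong induction gives the coefficients of (1 - z)⁻³, which satisfy the recursion
with every q_i = 2. -/
theorem ClassMData.norm_taylorCoeff_deriv_le (H : ClassMData α f h g) (n : ℕ) :
    ‖taylorCoeff (deriv h) n‖ ≤ ((n : ℝ) + 1) * (n + 2) / 2 := by
  have hφ : DifferentiableOn ℂ (deriv h) unitDisk := H.decomp.analytic_h.deriv Metric.isOpen_ball
  set q : ℂ → ℂ := fun z => (2 / 3) * (deriv (deriv h) z / deriv h z) with hq_def
  have hq : DifferentiableOn ℂ q unitDisk :=
    ((hφ.deriv Metric.isOpen_ball).div hφ H.ne_zero).const_mul (2 / 3)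
  have hre : ∀ z ∈ unitDisk, 0 < (1 + z * q z).re := by
    intro z hz
    have h1 := H.re_gt z hz
    have e : 1 + z * q z = ((2 / 3 : ℝ) : ℂ) * (1 + z * deriv (deriv h) z / deriv h z) +
        ((1 / 3 : ℝ) : ℂ) := by
      simp only [hq_def]; push_cast; ring
    rw [e, Complex.add_re, Complex.re_ofReal_mul, Complex.ofReal_re]
    linarith
  have hc := norm_taylorCoeff_le_two hq hre
  have hrec : ∀ n : ℕ, ((n : ℂ) + 1) * taylorCoeff (deriv h) (n + 1) = (3 / 2) *
      ∑ i ∈ Finset.range (n + 1), taylorCoeff q i * taylorCoeff (deriv h) (n - i) := by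
    intro n
    rw [← taylorCoeff_deriv, ← taylorCoeff_mul (analyticAt_of_mem hq zero_mem_unitDisk)
      (analyticAt_of_mem hφ zero_mem_unitDisk), ← taylorCoeff_const_mul]
    refine taylorCoeff_congr (fun z hz => ?_) n
    have := H.ne_zero z hz
    simp only [hq_def]
    field_simp
  induction n using Nat.strong_induction_on with
  | _ n ih =>
    rcases n with _ | n
    · simp [taylorCoeff, H.deriv_h_zero]
    · have h1 : ((n : ℝ) + 1) * ‖taylorCoeff (deriv h) (n + 1)‖ ≤
          3 * (((n : ℝ) + 1) * (n + 2) * (n + 3) / 6) := by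
        have e : ‖((n : ℂ) + 1)‖ = (n : ℝ) + 1 := by
          exact_mod_cast Complex.norm_natCast (n + 1)
        rw [← sum_range_triangular, ← e, ← norm_mul, hrec, norm_mul]
        calc ‖(3 / 2 : ℂ)‖ * ‖∑ i ∈ Finset.range (n + 1),
              taylorCoeff q i * taylorCoeff (deriv h) (n - i)‖
            ≤ (3 / 2) * ∑ i ∈ Finset.range (n + 1),
              2 * ((((n - i : ℕ) : ℝ) + 1) * (((n - i : ℕ) : ℝ) + 2) / 2) := by
              have : ‖(3 / 2 : ℂ)‖ = 3 / 2 := by simp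
              rw [this]
              gcongr
              refine norm_sum_le_of_le _ fun i hi => ?_
              rw [norm_mul]
              exact mul_le_mul (hc i) (ih (n - i) (by omega)) (norm_nonneg _) (by norm_num)
          _ = _ := by rw [← Finset.mul_sum]; ring
      have hn : (0 : ℝ) < (n : ℝ) + 1 := by positivity
      have : ((n : ℝ) + 1) * ‖taylorCoeff (deriv h) (n + 1)‖ ≤
          ((n : ℝ) + 1) * (((n + 1 : ℕ) : ℝ) + 1) * (((n + 1 : ℕ) : ℝ) + 2) / 2 := by
        push_cast; linarith
      rw [mul_assoc, mul_div_assoc] at this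
      exact le_of_mul_le_mul_left this hn

theorem ClassMData.norm_taylorCoeff_h_le (H : ClassMData α f h g) {n : ℕ} (hn : 1 ≤ n) :
    ‖taylorCoeff h n‖ ≤ ((n : ℝ) + 1) / 2 := by
  obtain ⟨n, rfl⟩ := Nat.exists_eq_add_of_le' hn
  have h1 := H.norm_taylorCoeff_deriv_le n
  have e : ‖((n : ℂ) + 1)‖ = (n : ℝ) + 1 := by exact_mod_cast Complex.norm_natCast (n + 1)
  rw [taylorCoeff_deriv, norm_mul, e, mul_div_assoc] at h1
  push_cast
  linarith [le_of_mul_le_mul_left h1 (by positivity)]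

theorem ClassMData.deriv_g_zero (H : ClassMData α f h g) : deriv g 0 = 0 := by
  rw [H.dilatation 0 zero_mem_unitDisk]; simp

theorem ClassMData.norm_taylorCoeff_g_le (H : ClassMData α f h g) {n : ℕ} (hn : 1 ≤ n) :
    ‖taylorCoeff g n‖ ≤ ((n : ℝ) - 1) / 2 * ‖α‖ := by
  obtain ⟨n, rfl⟩ := Nat.exists_eq_add_of_le' hn
  have hφ : DifferentiableOn ℂ (deriv h) unitDisk := H.decomp.analytic_h.deriv Metric.isOpen_ball
  have hg : Set.EqOn (deriv g) (fun z => α * (z * deriv h z)) unitDisk := fun z hz => by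
    rw [H.dilatation z hz, mul_assoc]
  have h1 := taylorCoeff_congr hg n
  have h2 := taylorCoeff_id_mul (analyticAt_of_mem hφ zero_mem_unitDisk)
  rw [taylorCoeff_deriv, taylorCoeff_const_mul] at h1
  rcases n with _ | n
  · rw [(h2 0).2] at h1
    simp at h1
    simp [h1]
  · rw [(h2 n).1] at h1
    have h3 := congrArg norm h1
    have e : ‖(((n + 1 : ℕ) : ℂ) + 1)‖ = (n : ℝ) + 2 := by
      have := Complex.norm_natCast (n + 2)
      push_cast at this ⊢
      rw [← this]; congr 1; ring
    rw [norm_mul, norm_mul, e] at h3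
    have h4 := H.norm_taylorCoeff_deriv_le n
    -- The relation g' = αzh' shifts the index by one: (n + 2)b_{n+2} = αc_n, where c_n is the n-th
    -- coefficient of h'.
    have h5 : ((n : ℝ) + 2) * ‖taylorCoeff g (n + 1 + 1)‖ ≤
        ((n : ℝ) + 2) * (((n + 1 + 1 : ℕ) - 1 : ℝ) / 2 * ‖α‖) := by
      rw [h3]
      push_cast
      nlinarith [norm_nonneg α, mul_le_mul_of_nonneg_left h4 (norm_nonneg α)]
    exact le_of_mul_le_mul_left h5 (by positivity)

end ClassM

/-! ### Extremal functions and their rotations. -/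

section Series

variable {𝕜 : Type*} [RCLike 𝕜]

/-- The value s = 1 gives the analytic part of f_α and s = -1 gives its g up to the factor α. The
complex case yields the extremal coefficients, the real case the majorants in the growth estimate.
-/
theorem hasSum_extremal {x : 𝕜} (hx : ‖x‖ < 1) (s : 𝕜) :
    HasSum (fun n : ℕ => (if n = 0 then 0 else ((n : 𝕜) + s) / 2) * x ^ n)
      ((1 / 2) * (x / (1 - x) ^ 2 + s * (x / (1 - x)))) := by
  have hx1 : 1 - x ≠ 0 := by
    intro h
    rw [sub_eq_zero] at h
    rw [← h] at hx
    simp at hx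
  have h1 := hasSum_coe_mul_geometric_of_norm_lt_one hx
  have h2 := hasSum_geometric_of_norm_lt_one hx
  have h3 := hasSum_single (f := fun n : ℕ => (if n = 0 then (1 : 𝕜) else 0)) 0
    (fun n hn => by simp [hn])
  have h4 := (h1.add ((h2.sub h3).mul_left s)).mul_left (1 / 2)
  convert! h4 using 1
  · funext n
    rcases eq_or_ne n 0 with rfl | hn
    · simp
    · simp only [hn, if_false]
      ring
  · simp only [if_true]
    congr 2
    field_simp
    ring

end Series

theorem one_sub_ne_zero_of_mem {z : ℂ} (hz : z ∈ unitDisk) : 1 - z ≠ 0 := by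
  intro h
  rw [sub_eq_zero] at h
  rw [← h] at hz
  simp at hz

section Extremal

theorem hasDerivAt_extremalH {z : ℂ} (hz : 1 - z ≠ 0) :
    HasDerivAt extremalH (1 / (1 - z) ^ 3) z := by
  have h1 : HasDerivAt (fun z : ℂ => 1 - z) (-1) z := (hasDerivAt_id z).const_sub 1
  have h2 := ((hasDerivAt_id z).fun_div h1 hz).fun_add
    ((hasDerivAt_id z).fun_div (h1.fun_pow 2) (pow_ne_zero 2 hz))
  have h3 := h2.const_mul (1 / 2)
  convert! h3 using 1
  simp only [id]
  field_simp
  ring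

theorem hasDerivAt_extremalG (α : ℂ) {z : ℂ} (hz : 1 - z ≠ 0) :
    HasDerivAt (extremalG α) (α * z * (1 / (1 - z) ^ 3)) z := by
  have h1 : HasDerivAt (fun z : ℂ => 1 - z) (-1) z := (hasDerivAt_id z).const_sub 1
  have h2 := ((hasDerivAt_id z).fun_div h1 hz).fun_sub
    ((hasDerivAt_id z).fun_div (h1.fun_pow 2) (pow_ne_zero 2 hz))
  have h3 := (h2.const_mul (1 / 2 * α)).fun_neg
  convert! h3 using 1
  simp only [id]
  field_simp
  ring

/-- Here 1 + zh''/h' = (3/2)(1 + μz)/(1 - μz) - 1/2, and the Cayley transform has positive real part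
on the disk. -/
theorem re_gt_of_deriv_eq {h : ℂ → ℂ} {μ : ℂ} (hμ : ‖μ‖ = 1)
    (hh : ∀ z ∈ unitDisk, deriv h z = 1 / (1 - μ * z) ^ 3) {z : ℂ} (hz : z ∈ unitDisk) :
    deriv h z ≠ 0 ∧ -(1 / 2 : ℝ) < (1 + z * deriv (deriv h) z / deriv h z).re := by
  have hz' : ‖μ * z‖ < 1 := by rw [norm_mul, hμ, one_mul]; simpa using hz
  have h0 : 1 - μ * z ≠ 0 := one_sub_ne_zero_of_mem (by simpa using hz')
  refine ⟨by rw [hh z hz]; exact one_div_ne_zero (pow_ne_zero 3 h0), ?_⟩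
  have hev : deriv h =ᶠ[𝓝 z] fun z => 1 / (1 - μ * z) ^ 3 := by
    filter_upwards [Metric.isOpen_ball.mem_nhds hz] with w hw using hh w hw
  have h1 : HasDerivAt (fun z : ℂ => 1 - μ * z) (-(μ * 1)) z :=
    ((hasDerivAt_id z).const_mul μ).const_sub 1
  have h2 := (hasDerivAt_const z (1 : ℂ)).fun_div (h1.fun_pow 3) (pow_ne_zero 3 h0)
  rw [hev.deriv_eq, hh z hz, h2.deriv]
  have e : 1 + z * ((0 * (1 - μ * z) ^ 3 - 1 * ((3 : ℕ) * (1 - μ * z) ^ (3 - 1) * -(μ * 1))) /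
      ((1 - μ * z) ^ 3) ^ 2) / (1 / (1 - μ * z) ^ 3) =
      ((3 / 2 : ℝ) : ℂ) * ((1 + μ * z) / (1 - μ * z)) + ((-(1 / 2) : ℝ) : ℂ) := by
    push_cast
    obtain ⟨d, hd⟩ : ∃ d, d = 1 - μ * z := ⟨_, rfl⟩
    rw [← hd] at h0 ⊢
    field_simp
    linear_combination 3 * hd
  rw [e, Complex.add_re, Complex.re_ofReal_mul, Complex.ofReal_re]
  have hpos : 0 < ((1 + μ * z) / (1 - μ * z)).re := by
    set w := μ * z
    have hn := Complex.normSq_pos.2 h0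
    have h3 : Complex.normSq w < 1 := by
      rw [Complex.normSq_eq_norm_sq]; nlinarith [norm_nonneg w]
    rw [Complex.normSq_apply] at h3
    rw [Complex.div_re, ← add_div]
    apply div_pos _ hn
    simp
    nlinarith
  linarith

theorem extremalData (α : ℂ) : ClassMData α (extremal α) extremalH (extremalG α) := by
  have hH : ∀ z ∈ unitDisk, deriv extremalH z = 1 / (1 - z) ^ 3 := fun z hz =>
    (hasDerivAt_extremalH (one_sub_ne_zero_of_mem hz)).deriv
  have hre := fun z (hz : z ∈ unitDisk) => re_gt_of_deriv_eq (h := extremalH) (μ := 1)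
    (by simp) (by simpa using hH) hz
  refine ⟨⟨fun z hz => ?_, fun z hz => ?_, by simp [extremalH], by simp [extremalG], ?_⟩, ?_, ?_,
    fun z hz => (hre z hz).1, fun z hz => (hre z hz).2⟩
  · exact (hasDerivAt_extremalH
      (one_sub_ne_zero_of_mem hz)).differentiableAt.differentiableWithinAt
  · exact (hasDerivAt_extremalG α
      (one_sub_ne_zero_of_mem hz)).differentiableAt.differentiableWithinAt
  · intro z _
    rw [extremal, extremalH, extremalG, map_neg, sub_eq_add_neg]
  · simp [hH 0 zero_mem_unitDisk]
  · intro z hz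
    rw [hH z hz, (hasDerivAt_extremalG α (one_sub_ne_zero_of_mem hz)).deriv]

theorem taylorCoeff_extremalH {n : ℕ} (hn : n ≠ 0) :
    taylorCoeff extremalH n = ((n : ℂ) + 1) / 2 := by
  rw [taylorCoeff_eq_of_hasSum (a := fun n : ℕ => if n = 0 then 0 else ((n : ℂ) + 1) / 2)
    (fun z hz => ?_), if_neg hn]
  convert! hasSum_extremal (x := z) (by simpa using hz) 1 using 1
  rw [extremalH]; ring

theorem taylorCoeff_extremalG (α : ℂ) {n : ℕ} (hn : n ≠ 0) :
    taylorCoeff (extremalG α) n = ((n : ℂ) - 1) / 2 * α := by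
  rw [taylorCoeff_eq_of_hasSum
    (a := fun n : ℕ => α * (if n = 0 then 0 else ((n : ℂ) + -1) / 2)) (fun z hz => ?_), if_neg hn]
  · ring
  · simp only [mul_assoc]
    convert! (hasSum_extremal (x := z) (by simpa using hz) (-1)).mul_left α using 1
    rw [extremalG]; ring

/-- The bound splits into the majorants of h and g, the cases s = 1 and s = -1 of the series above.
-/
theorem growthBound_eq {a r : ℝ} (hr : r < 1) : growthBound a r =
    (1 / 2) * (r / (1 - r) ^ 2 + 1 * (r / (1 - r))) +
      (1 / 2) * (r / (1 - r) ^ 2 + -1 * (r / (1 - r))) * a := by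
  have : 1 - r ≠ 0 := by linarith
  rw [growthBound]
  field_simp
  ring

theorem growthBound_nonneg {a r : ℝ} (ha : 0 ≤ a) (hr0 : 0 ≤ r) (hr : r < 1) :
    0 ≤ growthBound a r := by
  rw [growthBound]
  have : 0 ≤ 1 - 1 / 2 * (1 - a) * r := by nlinarith [mul_nonneg ha hr0]
  positivity

theorem extremal_ofReal {a r : ℝ} (hr : r < 1) :
    extremal (a : ℂ) (r : ℂ) = (growthBound a r : ℂ) := by
  have h1 : (1 - r : ℝ) ≠ 0 := by linarith
  have h2 : ((1 : ℂ) - r) ≠ 0 := by exact_mod_cast h1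
  rw [growthBound_eq hr, extremal]
  simp only [map_mul, map_sub, map_div₀, map_pow, map_one, Complex.conj_ofReal, map_ofNat]
  push_cast
  ring

/-- The chain rule turns the g-part into a function with derivative μ³|α|z/(1 - μz)³: one μ is the
prefactor, one the inner derivative, one the dilatation at μz. Hence the cube in the condition on μ.
-/
theorem rotationData {α μ : ℂ} (hμ : ‖μ‖ = 1) (hμα : μ ^ 3 * (‖α‖ : ℂ) = α) :
    ClassMData α (fun z => conj μ * extremal (‖α‖ : ℂ) (μ * z))
      (fun z => conj μ * extremalH (μ * z)) (fun z => μ * extremalG (‖α‖ : ℂ) (μ * z)) := by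
  have hmem : ∀ z ∈ unitDisk, μ * z ∈ unitDisk := fun z hz => by
    rw [mem_ball_zero_iff] at hz ⊢
    rwa [norm_mul, hμ, one_mul]
  have hmm := conj_mul_self_of_norm_eq_one hμ
  have hlin : ∀ z : ℂ, HasDerivAt (fun z => μ * z) (μ * 1) z := fun z =>
    (hasDerivAt_id z).const_mul μ
  have hH : ∀ z ∈ unitDisk, HasDerivAt (fun z => conj μ * extremalH (μ * z))
      (1 / (1 - μ * z) ^ 3) z := by
    intro z hz
    have := ((hasDerivAt_extremalH (one_sub_ne_zero_of_mem (hmem z hz))).comp z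
      (hlin z)).const_mul (conj μ)
    convert! this using 1
    linear_combination -(1 / (1 - μ * z) ^ 3) * hmm
  have hG : ∀ z ∈ unitDisk, HasDerivAt (fun z => μ * extremalG (‖α‖ : ℂ) (μ * z))
      (α * z * (1 / (1 - μ * z) ^ 3)) z := by
    intro z hz
    have := ((hasDerivAt_extremalG (‖α‖ : ℂ) (one_sub_ne_zero_of_mem (hmem z hz))).comp z
      (hlin z)).const_mul μ
    convert! this using 1
    linear_combination -(z * (1 / (1 - μ * z) ^ 3)) * hμα
  have hre := fun z (hz : z ∈ unitDisk) => re_gt_of_deriv_eq hμ (fun z hz => (hH z hz).deriv) hz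
  refine ⟨⟨fun z hz => (hH z hz).differentiableAt.differentiableWithinAt,
    fun z hz => (hG z hz).differentiableAt.differentiableWithinAt, by simp [extremalH],
    by simp [extremalG], fun z hz => ?_⟩, ?_, fun z hz => ?_, fun z hz => (hre z hz).1,
    fun z hz => (hre z hz).2⟩
  · simp only [(extremalData (‖α‖ : ℂ)).decomp.eq_add _ (hmem z hz), mul_add, map_mul]
  · simpa using (hH 0 zero_mem_unitDisk).deriv
  · rw [(hH z hz).deriv, (hG z hz).deriv]

theorem norm_rotation_eq (α : ℂ) {μ : ℂ} (hμ : ‖μ‖ = 1) {r : ℝ} (hr0 : 0 ≤ r) (hr : r < 1) :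
    ‖conj μ * extremal (‖α‖ : ℂ) (μ * (conj μ * (r : ℂ)))‖ = growthBound ‖α‖ r := by
  have e : μ * (conj μ * (r : ℂ)) = r := by
    rw [← mul_assoc, mul_comm μ, conj_mul_self_of_norm_eq_one hμ, one_mul]
  rw [e, extremal_ofReal hr, norm_mul, RCLike.norm_conj, hμ, one_mul, Complex.norm_real,
    Real.norm_of_nonneg (growthBound_nonneg (norm_nonneg α) hr0 hr)]

theorem exists_cube_root_rotation (α : ℂ) : ∃ μ : ℂ, ‖μ‖ = 1 ∧ μ ^ 3 * (‖α‖ : ℂ) = α := by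
  refine ⟨Complex.exp (((α.arg / 3 : ℝ) : ℂ) * Complex.I), Complex.norm_exp_ofReal_mul_I _, ?_⟩
  rw [← Complex.exp_nat_mul]
  conv_rhs => rw [← Complex.norm_mul_exp_arg_mul_I α]
  rw [mul_comm]
  congr 2
  push_cast
  ring

theorem minimalAreaData (α : ℂ) :
    ClassMData α (minimalArea α) (fun z => z) (fun z => α * z ^ 2 / 2) := by
  have hd1 : deriv (fun z : ℂ => z) = fun _ => 1 := by funext z; exact deriv_id z
  have hG : ∀ z : ℂ, HasDerivAt (fun z => α * z ^ 2 / 2) (α * z) z := by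
    intro z
    have := (((hasDerivAt_id z).fun_pow 2).const_mul α).div_const 2
    convert! this using 1
    simp
    ring
  refine ⟨⟨differentiableOn_id, fun z _ => (hG z).differentiableAt.differentiableWithinAt, rfl,
    by simp, fun z _ => rfl⟩, by rw [hd1], fun z _ => by rw [(hG z).deriv, hd1, mul_one],
    fun z _ => by rw [hd1]; exact one_ne_zero, fun z _ => ?_⟩
  rw [hd1]
  simp
  norm_num

end Extremal

/-! ### Growth estimate. -/

section Growth

variable {α : ℂ} {f h g : ℂ → ℂ}

theorem norm_le_of_taylorCoeff_le {φ : ℂ → ℂ} (hφ : DifferentiableOn ℂ φ unitDisk) (h0 : φ 0 = 0)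
    {s c : ℝ} (hc : ∀ n : ℕ, 1 ≤ n → ‖taylorCoeff φ n‖ ≤ ((n : ℝ) + s) / 2 * c) {z : ℂ}
    (hz : z ∈ unitDisk) :
    ‖φ z‖ ≤ (1 / 2) * (‖z‖ / (1 - ‖z‖) ^ 2 + s * (‖z‖ / (1 - ‖z‖))) * c := by
  have hz' : ‖(‖z‖ : ℝ)‖ < 1 := by simpa using hz
  refine (hasSum_taylorCoeff hφ hz).norm_le_of_bounded ((hasSum_extremal hz' s).mul_right c)
    fun n => ?_
  rcases eq_or_ne n 0 with rfl | hn
  · simp [taylorCoeff, h0]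
  · rw [if_neg hn, norm_mul, norm_pow]
    have := mul_le_mul_of_nonneg_right (hc n (Nat.one_le_iff_ne_zero.2 hn))
      (pow_nonneg (norm_nonneg z) n)
    linarith

theorem ClassMData.norm_le (H : ClassMData α f h g) {z : ℂ} (hz : z ∈ unitDisk) :
    ‖f z‖ ≤ growthBound ‖α‖ ‖z‖ := by
  have h1 := norm_le_of_taylorCoeff_le H.decomp.analytic_h H.decomp.h_zero (s := 1) (c := 1)
    (fun n hn => by simpa using H.norm_taylorCoeff_h_le hn) hz
  have h2 := norm_le_of_taylorCoeff_le H.decomp.analytic_g H.decomp.g_zero (s := -1) (c := ‖α‖)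
    (fun n hn => by simpa [sub_eq_add_neg] using H.norm_taylorCoeff_g_le hn) hz
  rw [H.decomp.eq_add z hz, growthBound_eq (by simpa using hz)]
  refine (norm_add_le _ _).trans ?_
  rw [RCLike.norm_conj]
  linarith

end Growth

/-! ### Area of the image. -/

open MeasureTheory

theorem det_harmonicDifferential (p q : ℂ) :
    (harmonicDifferential p q).det = ‖p‖ ^ 2 - ‖q‖ ^ 2 := by
  rw [ContinuousLinearMap.det, ← LinearMap.det_toMatrix Complex.basisOneI, Matrix.det_fin_two]
  simp only [LinearMap.toMatrix_apply, Complex.coe_basisOneI, Complex.coe_basisOneI_repr,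
    ContinuousLinearMap.coe_coe, harmonicDifferential_apply]
  simp [← Complex.normSq_eq_norm_sq, Complex.normSq_apply]
  ring

/-- The integral over a disk of an analytic function vanishing at the origin against a radial
weight is zero. -/
theorem setIntegral_radial_smul_eq_zero {φ : ℝ → ℝ} (hφ : Continuous φ) {P : ℂ → ℂ}
    (hP : DifferentiableOn ℂ P unitDisk) (hP0 : P 0 = 0) {r : ℝ} (hr : r < 1) :
    ∫ z in Metric.ball (0 : ℂ) r, φ ‖z‖ • P z = 0 := by
  set F : ℂ → ℂ := fun z => φ ‖z‖ • P z
  -- The integral is invariant under rotation of the integrand. Averaging over all rotations and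
  -- exchanging integrals leaves circle averages of P, which equal P(0) = 0.
  have hrot (t : ℝ) : ∫ z in Metric.ball (0 : ℂ) r, F (circleMap 0 1 t * z) =
      ∫ z in Metric.ball (0 : ℂ) r, F z := by
    have h := ((rotation (Circle.exp t)).measurePreserving).setIntegral_preimage_emb
      (rotation (Circle.exp t)).toHomeomorph.measurableEmbedding F (Metric.ball 0 r)
    have hpre : rotation (Circle.exp t) ⁻¹' Metric.ball (0 : ℂ) r = Metric.ball (0 : ℂ) r := by
      ext z
      simp [-LinearIsometryEquiv.preimage_ball]
    rw [hpre] at h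
    simpa [circleMap] using h
  have hint : Integrable (Function.uncurry fun (t : ℝ) z => F (circleMap 0 1 t * z))
      ((volume.restrict (Set.uIoc 0 (2 * Real.pi))).prod
        (volume.restrict (Metric.ball (0 : ℂ) r))) := by
    rw [Measure.prod_restrict]
    have hK : IsCompact (Set.uIcc 0 (2 * Real.pi) ×ˢ Metric.closedBall (0 : ℂ) r) :=
      isCompact_uIcc.prod (isCompact_closedBall 0 r)
    refine IntegrableOn.mono_set (ContinuousOn.integrableOn_compact hK ?_)
      (Set.prod_mono Set.uIoc_subset_uIcc Metric.ball_subset_closedBall)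
    have hc : Continuous fun p : ℝ × ℂ => circleMap 0 1 p.1 * p.2 := by
      have := continuous_circleMap 0 1
      fun_prop
    refine ((hφ.comp (continuous_norm.comp hc)).continuousOn).smul
      (hP.continuousOn.comp hc.continuousOn ?_)
    rintro ⟨t, z⟩ ⟨-, hz⟩
    simp at hz ⊢
    exact hz.trans_lt hr
  have hswap := intervalIntegral_integral_swap hint
  simp only [hrot] at hswap
  have hin : ∀ z ∈ Metric.ball (0 : ℂ) r,
      ∫ t in (0 : ℝ)..2 * Real.pi, F (circleMap 0 1 t * z) = 0 := by
    intro z hz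
    have hz1 : z ∈ unitDisk := by simp at hz ⊢; exact hz.trans hr
    have hd : DiffContOnCl ℂ (fun w => P (w * z)) (Metric.ball 0 |1|) := by
      have hz1' : ‖z‖ < 1 := by simpa using hz1
      refine DifferentiableOn.diffContOnCl ?_
      rw [abs_one, closure_ball _ one_ne_zero]
      refine hP.comp (by fun_prop) fun w hw => ?_
      simp at hw ⊢
      nlinarith [norm_nonneg z, norm_nonneg w]
    have hav := hd.circleAverage
    rw [Real.circleAverage, zero_mul, hP0, smul_eq_zero_iff_right (by positivity)] at hav
    simp only [F, norm_mul, norm_circleMap_zero, abs_one, one_mul]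
    rw [intervalIntegral.integral_smul, hav, smul_zero]
  rw [setIntegral_congr_fun measurableSet_ball hin, integral_zero] at hswap
  simpa [Real.pi_ne_zero] using hswap

theorem setIntegral_one_sub_mul_norm_sq (a : ℝ) {r : ℝ} (hr : 0 ≤ r) :
    ∫ z in Metric.ball (0 : ℂ) r, (1 - a * ‖z‖ ^ 2) = Real.pi * (r ^ 2 - a * r ^ 4 / 2) := by
  have h := integral_fun_norm_addHaar (volume : Measure ℂ)
    ((Set.Iio r).indicator fun y => 1 - a * y ^ 2)
  have e1 : (fun z : ℂ => (Set.Iio r).indicator (fun y => 1 - a * y ^ 2) ‖z‖) =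
      (Metric.ball (0 : ℂ) r).indicator fun z => 1 - a * ‖z‖ ^ 2 := by
    ext z; simp [Set.indicator]
  rw [e1, integral_indicator measurableSet_ball] at h
  rw [h]
  have e2 : ∀ y : ℝ, y ^ (Module.finrank ℝ ℂ - 1) • (Set.Iio r).indicator (fun y => 1 - a * y ^ 2) y
      = (Set.Iio r).indicator (fun y => y - a * y ^ 3) y := by
    intro y
    by_cases hy : y < r <;> simp [Set.indicator, hy, Complex.finrank_real_complex]
    ring
  simp only [e2]
  rw [setIntegral_indicator measurableSet_Iio, Set.Ioi_inter_Iio, ← integral_Ioc_eq_integral_Ioo,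
    ← intervalIntegral.integral_of_le hr, intervalIntegral.integral_sub (by simp)
    (Continuous.intervalIntegrable (by fun_prop) _ _), intervalIntegral.integral_const_mul,
    integral_pow, integral_id]
  simp [Measure.real, Complex.finrank_real_complex]
  ring

variable {α : ℂ} {f h g : ℂ → ℂ}

/-- The area of the image of a disk of radius `r < 1`. -/
theorem ClassMData.volume_image_ball (H : ClassMData α f h g) (hα : ‖α‖ ≤ 1) {r : ℝ}
    (hr0 : 0 ≤ r) (hr : r < 1) :
    volume (f '' Metric.ball 0 r) = ENNReal.ofReal (Real.pi * (r ^ 2 - ‖α‖ ^ 2 * r ^ 4 / 2) +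
      ∫ z in Metric.ball (0 : ℂ) r, (1 - ‖α‖ ^ 2 * ‖z‖ ^ 2) * ‖deriv h z - 1‖ ^ 2) := by
  have hsub : Metric.closedBall (0 : ℂ) r ⊆ unitDisk := Metric.closedBall_subset_ball hr
  have hsub' : Metric.ball (0 : ℂ) r ⊆ unitDisk := Metric.ball_subset_ball hr.le
  have hP : DifferentiableOn ℂ (fun z => deriv h z - 1) unitDisk :=
    (H.decomp.analytic_h.deriv Metric.isOpen_ball).sub_const 1
  have hPc := hP.continuousOn.mono hsub
  have hi : ∀ {F : ℂ → ℝ}, ContinuousOn F (Metric.closedBall (0 : ℂ) r) →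
      IntegrableOn F (Metric.ball 0 r) := fun hF =>
    (hF.integrableOn_compact (isCompact_closedBall 0 r)).mono_set Metric.ball_subset_closedBall
  -- The Jacobian is split around h' = 1: the first term gives the explicit area, the linear one
  -- integrates to zero, and the quadratic one is the defect.
  have hdet : ∀ z ∈ Metric.ball (0 : ℂ) r,
      |(harmonicDifferential (deriv h z) (deriv g z)).det| =
        (1 - ‖α‖ ^ 2 * ‖z‖ ^ 2) + 2 * ((1 - ‖α‖ ^ 2 * ‖z‖ ^ 2) • (deriv h z - 1)).re +
          (1 - ‖α‖ ^ 2 * ‖z‖ ^ 2) * ‖deriv h z - 1‖ ^ 2 := by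
    intro z hz
    have hlt := H.norm_deriv_lt hα (hsub' hz)
    rw [det_harmonicDifferential, abs_of_pos (by nlinarith [norm_nonneg (deriv g z)]),
      H.dilatation z (hsub' hz), norm_mul, norm_mul]
    have : ‖deriv h z‖ ^ 2 = 1 + 2 * (deriv h z - 1).re + ‖deriv h z - 1‖ ^ 2 := by
      simp only [← Complex.normSq_eq_norm_sq, Complex.normSq_apply]
      simp
      ring
    rw [Complex.smul_re, smul_eq_mul]
    linear_combination (1 - ‖α‖ ^ 2 * ‖z‖ ^ 2) * this
  have hw : Continuous fun z : ℂ => 1 - ‖α‖ ^ 2 * ‖z‖ ^ 2 := by fun_prop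
  have hsc : ContinuousOn (fun z => (1 - ‖α‖ ^ 2 * ‖z‖ ^ 2) • (deriv h z - 1))
      (Metric.closedBall (0 : ℂ) r) := hw.continuousOn.smul hPc
  have i1 : IntegrableOn (fun z => 1 - ‖α‖ ^ 2 * ‖z‖ ^ 2) (Metric.ball (0 : ℂ) r) :=
    hi hw.continuousOn
  have i2 : IntegrableOn (fun z => 2 * ((1 - ‖α‖ ^ 2 * ‖z‖ ^ 2) • (deriv h z - 1)).re)
      (Metric.ball (0 : ℂ) r) := (hi (Complex.continuous_re.comp_continuousOn hsc)).const_mul 2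
  have i3 : IntegrableOn (fun z => (1 - ‖α‖ ^ 2 * ‖z‖ ^ 2) * ‖deriv h z - 1‖ ^ 2)
      (Metric.ball (0 : ℂ) r) := hi (hw.continuousOn.mul (hPc.norm.pow 2))
  rw [← lintegral_abs_det_fderiv_eq_addHaar_image volume measurableSet_ball
    (fun z hz => (H.decomp.hasFDerivAt (hsub' hz)).hasFDerivWithinAt)
    ((H.injOn hα).mono hsub'),
    ← ofReal_integral_eq_lintegral_ofReal ?_ (Eventually.of_forall fun _ => abs_nonneg _),
    setIntegral_congr_fun measurableSet_ball hdet]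
  · congr 1
    have hzero := setIntegral_radial_smul_eq_zero (φ := fun t => 1 - ‖α‖ ^ 2 * t ^ 2)
      (by fun_prop) hP (by simp [H.deriv_h_zero]) hr
    have hre := integral_re (𝕜 := ℂ) ((hsc.integrableOn_compact (μ := volume)
      (isCompact_closedBall 0 r)).mono_set Metric.ball_subset_closedBall)
    rw [hzero] at hre
    simp only [RCLike.re_eq_complex_re, Complex.zero_re] at hre
    rw [integral_add (by exact i1.add i2) i3, integral_add i1 i2,
      setIntegral_one_sub_mul_norm_sq _ hr0, integral_const_mul, hre]
    ring
  · exact ((i1.add i2).add i3).congr_fun (fun z hz => (hdet z hz).symm) measurableSet_ball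

theorem weight_pos (hα : ‖α‖ ≤ 1) {z : ℂ} (hz : z ∈ unitDisk) : 0 < 1 - ‖α‖ ^ 2 * ‖z‖ ^ 2 := by
  have hz' : ‖z‖ < 1 := by simpa using hz
  have h1 : ‖α‖ * ‖z‖ < 1 := by nlinarith [norm_nonneg z, norm_nonneg α]
  nlinarith [mul_nonneg (norm_nonneg α) (norm_nonneg z)]

theorem weighted_integral_mono (H : ClassMData α f h g) (hα : ‖α‖ ≤ 1) {s r : ℝ}
    (hsr : s ≤ r) (hr : r < 1) :
    ∫ z in Metric.ball (0 : ℂ) s, (1 - ‖α‖ ^ 2 * ‖z‖ ^ 2) * ‖deriv h z - 1‖ ^ 2 ≤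
      ∫ z in Metric.ball (0 : ℂ) r, (1 - ‖α‖ ^ 2 * ‖z‖ ^ 2) * ‖deriv h z - 1‖ ^ 2 := by
  refine setIntegral_mono_set ?_ ?_ (Metric.ball_subset_ball hsr).eventuallyLE
  · refine ((ContinuousOn.integrableOn_compact (isCompact_closedBall (0 : ℂ) r) ?_).mono_set
      Metric.ball_subset_closedBall)
    have := (H.decomp.analytic_h.deriv Metric.isOpen_ball).continuousOn.mono
      (Metric.closedBall_subset_ball hr)
    fun_prop
  · filter_upwards [ae_restrict_mem measurableSet_ball] with z hz
    exact mul_nonneg (weight_pos hα (Metric.ball_subset_ball hr.le hz)).le (sq_nonneg _)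

/-- The defect over a fixed disk of radius s is kept while the outer radius tends to 1. The retained
term decides the case of equality. -/
theorem ClassMData.ofReal_add_le_volume (H : ClassMData α f h g) (hα : ‖α‖ ≤ 1) {s : ℝ}
    (hs : s < 1) :
    ENNReal.ofReal (Real.pi * (1 - ‖α‖ ^ 2 / 2) +
      ∫ z in Metric.ball (0 : ℂ) s, (1 - ‖α‖ ^ 2 * ‖z‖ ^ 2) * ‖deriv h z - 1‖ ^ 2) ≤
        volume (f '' unitDisk) := by
  set c := ∫ z in Metric.ball (0 : ℂ) s, (1 - ‖α‖ ^ 2 * ‖z‖ ^ 2) * ‖deriv h z - 1‖ ^ 2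
  have hlim : Tendsto (fun r : ℝ => ENNReal.ofReal
      (Real.pi * (r ^ 2 - ‖α‖ ^ 2 * r ^ 4 / 2) + c)) (𝓝[<] 1)
      (𝓝 (ENNReal.ofReal (Real.pi * (1 - ‖α‖ ^ 2 / 2) + c))) := by
    refine (ENNReal.continuous_ofReal.tendsto _).comp (Tendsto.mono_left ?_ nhdsWithin_le_nhds)
    have : Continuous fun r : ℝ => Real.pi * (r ^ 2 - ‖α‖ ^ 2 * r ^ 4 / 2) + c := by fun_prop
    simpa using this.tendsto 1
  refine le_of_tendsto hlim ?_
  filter_upwards [Ioo_mem_nhdsLT (max_lt hs one_pos)] with r ⟨hr, hr1⟩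
  rw [max_lt_iff] at hr
  calc _ ≤ volume (f '' Metric.ball 0 r) := by
        rw [H.volume_image_ball hα hr.2.le hr1]
        gcongr
        exact weighted_integral_mono H hα hr.1.le hr1
    _ ≤ _ := measure_mono (Set.image_mono (Metric.ball_subset_ball hr1.le))

theorem ClassMData.ofReal_le_volume (H : ClassMData α f h g) (hα : ‖α‖ ≤ 1) :
    ENNReal.ofReal (Real.pi * (1 - ‖α‖ ^ 2 / 2)) ≤ volume (f '' unitDisk) := by
  -- For s = 0 the ball is empty and the defect vanishes.
  simpa using H.ofReal_add_le_volume hα (s := 0) one_pos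

/-- If h' ≠ 1 at one point, then also on an open set, and the defect over a slightly larger disk is
strictly positive. -/
theorem ClassMData.deriv_h_eq_one (H : ClassMData α f h g) (hα : ‖α‖ ≤ 1)
    (hv : volume (f '' unitDisk) = ENNReal.ofReal (Real.pi * (1 - ‖α‖ ^ 2 / 2))) {z : ℂ}
    (hz : z ∈ unitDisk) : deriv h z = 1 := by
  by_contra hne
  obtain ⟨s, hzs, hs⟩ := exists_between (show ‖z‖ < 1 by simpa using hz)
  have hc := (H.decomp.analytic_h.deriv Metric.isOpen_ball).continuousOn
  have hpos : 0 < ∫ z in Metric.ball (0 : ℂ) s,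
      (1 - ‖α‖ ^ 2 * ‖z‖ ^ 2) * ‖deriv h z - 1‖ ^ 2 := by
    rw [setIntegral_pos_iff_support_of_nonneg_ae]
    · have hopen : IsOpen (Metric.ball (0 : ℂ) s ∩ {w | deriv h w ≠ 1}) :=
        (hc.mono (Metric.ball_subset_ball hs.le)).isOpen_inter_preimage Metric.isOpen_ball
          isOpen_ne
      refine (hopen.measure_pos volume ⟨z, by simpa using hzs, hne⟩).trans_le
        (measure_mono fun w hw => ⟨?_, hw.1⟩)
      exact mul_ne_zero (weight_pos hα (Metric.ball_subset_ball hs.le hw.1)).ne'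
        (pow_ne_zero 2 (norm_ne_zero_iff.2 (sub_ne_zero.2 hw.2)))
    · filter_upwards [ae_restrict_mem measurableSet_ball] with w hw
      exact mul_nonneg (weight_pos hα (Metric.ball_subset_ball hs.le hw)).le (sq_nonneg _)
    · refine ((ContinuousOn.integrableOn_compact (isCompact_closedBall (0 : ℂ) s) ?_).mono_set
        Metric.ball_subset_closedBall)
      have := hc.mono (Metric.closedBall_subset_ball hs)
      fun_prop
  have hle := H.ofReal_add_le_volume hα hs
  have h1 : 0 ≤ Real.pi * (1 - ‖α‖ ^ 2 / 2) :=
    mul_nonneg Real.pi_pos.le (by nlinarith [norm_nonneg α])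
  rw [hv, ENNReal.ofReal_le_ofReal_iff h1] at hle
  linarith

theorem volume_minimalArea_image (hα : ‖α‖ ≤ 1) :
    volume (minimalArea α '' unitDisk) = ENNReal.ofReal (Real.pi * (1 - ‖α‖ ^ 2 / 2)) := by
  have H := minimalAreaData α
  refine le_antisymm ?_ (H.ofReal_le_volume hα)
  have hlim : Tendsto (fun n : ℕ => (1 : ℝ) - 1 / ((n : ℝ) + 1)) atTop (𝓝 1) := by
    simpa using tendsto_one_div_add_atTop_nhds_zero_nat.const_sub (1 : ℝ)
  have hmono : Monotone fun n : ℕ => (1 : ℝ) - 1 / ((n : ℝ) + 1) := fun m n hmn => by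
    dsimp only
    gcongr
  have hU : minimalArea α '' unitDisk =
      ⋃ n : ℕ, minimalArea α '' Metric.ball 0 (1 - 1 / ((n : ℝ) + 1)) := by
    rw [← Set.image_iUnion]
    congr 1
    ext z
    simp only [Set.mem_iUnion, Metric.mem_ball, dist_zero_right]
    exact ⟨fun hz => (hlim.eventually (lt_mem_nhds hz)).exists,
      fun ⟨n, hn⟩ => hn.trans (sub_lt_self _ (by positivity))⟩
  rw [hU, Monotone.measure_iUnion fun m n hmn =>
    Set.image_mono (Metric.ball_subset_ball (hmono hmn))]
  refine iSup_le fun n => ?_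
  have hp : 0 < 1 / ((n : ℝ) + 1) := by positivity
  have hp1 : 1 / ((n : ℝ) + 1) ≤ 1 := by
    rw [div_le_one (by positivity)]; simp
  rw [H.volume_image_ball hα (by linarith) (by linarith)]
  refine ENNReal.ofReal_le_ofReal ?_
  set r := 1 - 1 / ((n : ℝ) + 1)
  simp only [deriv_id'', sub_self, norm_zero, ne_eq, OfNat.ofNat_ne_zero, not_false_eq_true,
    zero_pow, mul_zero, integral_zero, add_zero]
  have hr0 : 0 ≤ r := by simp only [r]; linarith
  have hr1 : r < 1 := by simp only [r]; linarith
  refine mul_le_mul_of_nonneg_left ?_ Real.pi_pos.le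
  have h2 : r ^ 2 ≤ 1 := by nlinarith
  have h3 : ‖α‖ ^ 2 ≤ 1 := by nlinarith [norm_nonneg α]
  -- With A = |α|² and t = r², the difference of the two sides is (1 - t)(1 - A) + A(1 - t)²/2.
  nlinarith [mul_nonneg (sub_nonneg.2 h2) (sub_nonneg.2 h3), sq_nonneg (1 - r ^ 2),
    mul_nonneg (sq_nonneg ‖α‖) (sq_nonneg (1 - r ^ 2))]

theorem ClassMData.volume_image_eq_iff (H : ClassMData α f h g) (hα : ‖α‖ ≤ 1) :
    volume (f '' unitDisk) = ENNReal.ofReal (Real.pi * (1 - ‖α‖ ^ 2 / 2)) ↔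
      Set.EqOn f (minimalArea α) unitDisk := by
  refine ⟨fun hv => ?_, fun he => by rw [he.image_eq, volume_minimalArea_image hα]⟩
  have M := minimalAreaData α
  have hd : ∀ z ∈ unitDisk, deriv h z = deriv (fun z : ℂ => z) z := fun z hz => by
    rw [H.deriv_h_eq_one hα hv hz]; simp
  have e1 := eqOn_of_deriv_eq H.decomp.analytic_h M.decomp.analytic_h
    (H.decomp.h_zero.trans M.decomp.h_zero.symm) hd
  have e2 := eqOn_of_deriv_eq H.decomp.analytic_g M.decomp.analytic_g
    (H.decomp.g_zero.trans M.decomp.g_zero.symm)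
    fun z hz => by rw [H.dilatation z hz, M.dilatation z hz, hd z hz]
  intro z hz
  rw [H.decomp.eq_add z hz, M.decomp.eq_add z hz, e1 hz, e2 hz]

end HarmonicMappings

theorem theorem3p1 (α : ℂ) (hα : ‖α‖ ≤ 1) :
    -- (i)
    HarmonicMappings.classM α ⊆ HarmonicMappings.classCH0 ∧
    -- (ii) coefficient estimates
    (∀ f ∈ HarmonicMappings.classM α, ∀ h g : ℂ → ℂ, HarmonicMappings.IsDecomposition f h g →
      HarmonicMappings.taylorCoeff g 1 = 0 ∧ deriv g 0 = 0 ∧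
      ∀ n : ℕ, 2 ≤ n →
        ‖HarmonicMappings.taylorCoeff h n‖ ≤ ((n : ℝ) + 1) / 2 ∧
        ‖HarmonicMappings.taylorCoeff g n‖ ≤ ((n : ℝ) - 1) / 2 * ‖α‖) ∧
    -- sharpness of (ii)
    (HarmonicMappings.extremal α ∈ HarmonicMappings.classM α ∧
      HarmonicMappings.IsDecomposition (HarmonicMappings.extremal α)
        HarmonicMappings.extremalH (HarmonicMappings.extremalG α) ∧
      ∀ n : ℕ, 2 ≤ n →
        ‖HarmonicMappings.taylorCoeff HarmonicMappings.extremalH n‖ = ((n : ℝ) + 1) / 2 ∧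
        ‖HarmonicMappings.taylorCoeff (HarmonicMappings.extremalG α) n‖
          = ((n : ℝ) - 1) / 2 * ‖α‖) ∧
    -- (iii) growth theorem
    (∀ f ∈ HarmonicMappings.classM α, ∀ z ∈ HarmonicMappings.unitDisk,
      ‖f z‖ ≤ HarmonicMappings.growthBound ‖α‖ ‖z‖) ∧
    -- sharpness of (iii), for every `α` and every radius
    (∃ f ∈ HarmonicMappings.classM α, ∀ r : ℝ, 0 ≤ r → r < 1 →
      ∃ z : ℂ, ‖z‖ = r ∧ ‖f z‖ = HarmonicMappings.growthBound ‖α‖ r) ∧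
    -- the extremal functions in (iii) are rotations of `f_{|α|}`; `μ = 1` is allowed if `0 ≤ α`
    (∀ μ : ℂ, ‖μ‖ = 1 → μ ^ 3 * (‖α‖ : ℂ) = α →
      (fun z => (starRingEnd ℂ) μ * HarmonicMappings.extremal (‖α‖ : ℂ) (μ * z))
          ∈ HarmonicMappings.classM α ∧
      ∀ r : ℝ, 0 ≤ r → r < 1 →
        ‖(starRingEnd ℂ) μ * HarmonicMappings.extremal (‖α‖ : ℂ)
            (μ * ((starRingEnd ℂ) μ * (r : ℂ)))‖ = HarmonicMappings.growthBound ‖α‖ r) ∧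
    -- (iv) area theorem
    (∀ f ∈ HarmonicMappings.classM α,
      ENNReal.ofReal (Real.pi * (1 - ‖α‖ ^ 2 / 2))
          ≤ MeasureTheory.volume (f '' HarmonicMappings.unitDisk) ∧
      (MeasureTheory.volume (f '' HarmonicMappings.unitDisk)
          = ENNReal.ofReal (Real.pi * (1 - ‖α‖ ^ 2 / 2)) ↔
        Set.EqOn f (HarmonicMappings.minimalArea α) HarmonicMappings.unitDisk)) ∧
    HarmonicMappings.minimalArea α ∈ HarmonicMappings.classM α := by
  open HarmonicMappings in
  refine ⟨classM_subset_classCH0 hα, fun f hf h g hd => ?_, ?_, fun f hf z hz => ?_, ?_,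
    fun μ hμ hμα => ⟨mem_classM_iff.2 ⟨_, _, rotationData hμ hμα⟩,
      fun r hr0 hr => norm_rotation_eq α hμ hr0 hr⟩, fun f hf => ?_,
    mem_classM_iff.2 ⟨_, _, minimalAreaData α⟩⟩
  · obtain ⟨h', g', H⟩ := mem_classM_iff.1 hf
    obtain ⟨hh, hg⟩ := hd.unique H.decomp
    have hg1 : deriv g 0 = 0 := by
      rw [(hg.eventuallyEq_of_mem (Metric.isOpen_ball.mem_nhds zero_mem_unitDisk)).deriv_eq,
        H.deriv_g_zero]
    refine ⟨by simp [taylorCoeff, hg1], hg1, fun n hn => ?_⟩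
    rw [taylorCoeff_congr hh, taylorCoeff_congr hg]
    exact ⟨H.norm_taylorCoeff_h_le (by lia), H.norm_taylorCoeff_g_le (by lia)⟩
  · refine ⟨mem_classM_iff.2 ⟨_, _, extremalData α⟩, (extremalData α).decomp, fun n hn => ?_⟩
    obtain ⟨m, rfl⟩ := Nat.exists_eq_add_of_le' hn
    rw [taylorCoeff_extremalH (by lia), taylorCoeff_extremalG α (by lia), norm_mul, norm_div,
      norm_div, Complex.norm_ofNat]
    have e1 : ((m + 2 : ℕ) : ℂ) + 1 = ((m + 3 : ℕ) : ℂ) := by push_cast; ring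
    have e2 : ((m + 2 : ℕ) : ℂ) - 1 = ((m + 1 : ℕ) : ℂ) := by push_cast; ring
    rw [e1, e2, Complex.norm_natCast, Complex.norm_natCast]
    push_cast
    constructor <;> ring
  · obtain ⟨h, g, H⟩ := mem_classM_iff.1 hf
    exact H.norm_le hz
  · obtain ⟨μ, hμ, hμα⟩ := exists_cube_root_rotation α
    exact ⟨_, mem_classM_iff.2 ⟨_, _, rotationData hμ hμα⟩, fun r hr0 hr =>
      ⟨(starRingEnd ℂ) μ * (r : ℂ), by simp [hμ, abs_of_nonneg hr0],
        norm_rotation_eq α hμ hr0 hr⟩⟩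
  · obtain ⟨h, g, H⟩ := mem_classM_iff.1 hf
    exact ⟨H.ofReal_le_volume hα, H.volume_image_eq_iff hα⟩
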